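/- Let $N \ge 1$ and let $P_N$ be the joint law of the eigenvalues $z_1,\dots,z_N$ of the $N\times N$ complex Ginibre ensemble with entries of variance $1/N$, that is, the probability measure on $\mathbb{C}^N$ $$dP_N(z_1,\dots,z_N)=\frac1{Z_N}\prod_{1\le \ell<k\le N}|z_\ell-z_k|^2\prod_{k=1}^N e^{-N|z_k|^2}\,d\Re(z_k)\,d\Im(z_k).$$ Let $\mathbb{T}=[-\pi,\pi]$ with endpoints identified and with Lebesgue measure normalized so that $\int_{\mathbb{T}}d\theta=1$. For an integrable function $f:\mathbb{T}\to\mathbb{C}$ of the phase write $X(f)=\sum_{k=1}^N f(\arg z_k)$ and $\widehat f(k)=\int_{\mathbb{T}}e^{-ik\theta}f(\theta)\,d\theta$, and let $$\mathrm{Cov}_N(X(f),X(g))=\int X(f)X(g)\,dP_N-\int X(f)\,dP_N\int X(g)\,dP_N.$$ Suppose that $f,g$ are integrable with $\sum_{k\in\mathbb{Z}}k^2|\widehat f(k)|^2<\infty$ and $\sum_{k\in\mathbb{Z}}k^2|\widehat g(k)|^2<\infty$. Then $f$ and $g$ have weak derivatives $f',g'\in L^2(\mathbb{T})$, the statistics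 $X(f)$ and $X(g)$ are square integrable under $P_N$ for every $N$, and, as $N\to\infty$, $$\mathrm{Cov}_N\bigl(X(f),X(g)\bigr)=\frac{\log N}{4}\int_{\mathbb{T}}f'(\theta)g'(\theta)\,d\theta+o(\log N).$$ If moreover, for some $\delta>0$, at least one of $\sum_{k\in\mathbb{Z}}|k|^{2+\delta}|\widehat f(k)|^2<\infty$ and $\sum_{k\in\mathbb{Z}}|k|^{2+\delta}|\widehat g(k)|^2<\infty$ holds, then the error term $o(\log N)$ may be replaced by $O(1)$. -/

import Mathlib

open MeasureTheory Filter Asymptotics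
open scoped Real ContDiff

noncomputable section

/-- The circle `[-π, π]` with its endpoints identified. -/
abbrev Circ : Type := AddCircle (2 * π)

instance Circ.fact_two_pi_pos : Fact (0 < 2 * π) := ⟨Real.two_pi_pos⟩

/-- The normalized Lebesgue measure on the circle, of total mass one. -/
abbrev circMeasure : Measure Circ := AddCircle.haarAddCircle

/-- The measure `exp (-N |z|²) dRe(z) dIm(z)` on the complex plane. -/
def ginibreWeight (N : ℕ) : Measure ℂ :=
  (volume : Measure ℂ).withDensity fun z => ENNReal.ofReal (Real.exp (-(N : ℝ) * ‖z‖ ^ 2))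

/-- The eigenvalue density of the complex Ginibre ensemble before normalization:
`∏_{l < k} |z_l - z_k|²` with respect to the `N`-fold product of `ginibreWeight N`. -/
def ginibreUnnormalized (N : ℕ) : Measure (Fin N → ℂ) :=
  (Measure.pi fun _ : Fin N => ginibreWeight N).withDensity fun z =>
    ENNReal.ofReal (∏ l : Fin N, ∏ k ∈ Finset.Ioi l, ‖z l - z k‖ ^ 2)

/-- The joint law `P_N` of the eigenvalues: the previous measure divided by its total mass. -/
def ginibreLaw (N : ℕ) : Measure (Fin N → ℂ) :=
  (ginibreUnnormalized N Set.univ)⁻¹ • ginibreUnnormalized N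

/-- The linear statistic `X(F) = ∑ₖ F(zₖ)`. -/
def linearStatistic {N : ℕ} (F : ℂ → ℂ) (z : Fin N → ℂ) : ℂ := ∑ k, F (z k)

/-- A function of the phase, seen as a function on the plane: `z ↦ f(arg z)`. -/
def ofPhase (f : Circ → ℂ) (z : ℂ) : ℂ := f ((Complex.arg z : ℝ) : Circ)

/-- `Cov_N(X(F), X(G)) = E_N[X(F) X(G)] - E_N[X(F)] E_N[X(G)]`, bilinear in `(F, G)`. -/
def ginibreCov (N : ℕ) (F G : ℂ → ℂ) : ℂ :=
  (∫ z, linearStatistic F z * linearStatistic G z ∂ginibreLaw N) -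
    (∫ z, linearStatistic F z ∂ginibreLaw N) * ∫ z, linearStatistic G z ∂ginibreLaw N

/-- `f'` is a weak derivative of `f` on the circle: both are integrable, and integration by parts
holds against every smooth `2π`-periodic test function. -/
def HasWeakDeriv (f f' : Circ → ℂ) : Prop :=
  Integrable f circMeasure ∧ Integrable f' circMeasure ∧
    ∀ φ : ℝ → ℂ, ContDiff ℝ ∞ φ → Function.Periodic φ (2 * π) →
      ∫ θ in (-π)..π, f (θ : Circ) * deriv φ θ = -∫ θ in (-π)..π, f' (θ : Circ) * φ θ

end

/-!
The Ginibre law has density proportional to `|det (φ_a(z_k))|²`, where the `φ_a` are the monomials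
`z ^ a`, `a < N`, orthonormalized for the weight `exp (-N |z|²)`. For such a density, Andréief's
identity expresses the covariance of two linear statistics through the matrix entries
`F_ab = ∫ F φ_a conj φ_b`: it is `∑ₐ (F G)_aa - ∑ₐ ∑_b F_ab G_ba`
(`integral_sum_mul_sum_mul_biorthDensity`). When `F = f ∘ arg`, polar coordinates give
`F_ab = f̂(b - a) Γ((a + b)/2 + 1) / √(a! b!)` (`mulEntry_ofPhase`), and together with Parseval's
identity the covariance becomes `∑ₘ c_N(|m|) f̂(m) ĝ(-m)` (`hasSum_ginibreCov`), with
`c_N(m) = N - ∑_{j < N - m} r(j)` and `r(j) = Γ(j + m/2 + 1)² / (j! (j + m)!)`.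

The ratios satisfy `r(j+1) = r(j) (1 + (m²/4) / ((j+1) (j+1+m)))` and tend to `1` by log-convexity
of the Gamma function. Comparing with telescoping sequences gives
`(m²/4) / (j + (1 + m/2)²) ≤ 1 - r(j) ≤ (m²/4) / (j+1)`, and harmonic sums then yield
`c_N(m) = (m²/4) log N + O(m² (1 + log (1 + m/2)))` uniformly in `N` (`abs_covCoeff_sub_le`), as
well as an error `O(m² log N)` (`abs_covCoeff_sub_le_log`).

On the other side, `∫ f' g' = ∑ₘ m² f̂(m) ĝ(-m)` (`hasSum_sq_mul_fourierCoeff`). The difference is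
thus a series in `m` to which dominated convergence applies after division by `log N`; if one of the
functions has slightly more regularity, the logarithm in the uniform error is absorbed and the
series is bounded.

The functions `f` and `g` are only integrable, so they are first replaced by continuous
representatives (`exists_continuous_ae_eq`). This does not change the statistics almost surely, as
the phase of a point of the plane has an absolutely continuous law (`ae_arg_of_ae`).
-/

/-! ### Ratios of Gamma values at half-integers -/

/-- The squared normalized moment `Γ(j + m/2 + 1)² / (j! (j + m)!)`. -/
noncomputable def gammaRatio (m j : ℕ) : ℝ :=
  Real.Gamma (j + m / 2 + 1) ^ 2 / (j.factorial * (j + m).factorial)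

theorem gammaRatio_pos (m j : ℕ) : 0 < gammaRatio m j := by
  have h : 0 < Real.Gamma (j + m / 2 + 1) := Real.Gamma_pos_of_pos (by positivity)
  unfold gammaRatio
  positivity

theorem gammaRatio_zero (j : ℕ) : gammaRatio 0 j = 1 := by
  have h : (j.factorial : ℝ) ≠ 0 := by positivity
  simp only [gammaRatio, Nat.cast_zero, zero_div, add_zero, Real.Gamma_nat_eq_factorial]
  field_simp

theorem gammaRatio_succ (m j : ℕ) :
    gammaRatio m (j + 1) =
      gammaRatio m j * (1 + (m : ℝ) ^ 2 / 4 / ((j + 1) * (j + 1 + m))) := by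
  have h : Real.Gamma ((j + 1 : ℕ) + m / 2 + 1) =
      (j + m / 2 + 1) * Real.Gamma (j + m / 2 + 1) := by
    rw [← Real.Gamma_add_one (by positivity)]
    push_cast
    ring_nf
  rw [gammaRatio, gammaRatio, h, show j + 1 + m = (j + m) + 1 by ring, Nat.factorial_succ,
    Nat.factorial_succ]
  push_cast
  field_simp
  ring

/-- Log-convexity of the Gamma function, compared with its slopes over unit intervals. -/
theorem neg_log_gammaRatio_le (m j : ℕ) (hj : 0 < j) :
    -Real.log (gammaRatio m j) ≤ m / 2 * (Real.log (j + m + 1) - Real.log j) := by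
  rcases Nat.eq_zero_or_pos m with rfl | hm
  · simp [gammaRatio_zero]
  have hj' : (0 : ℝ) < j := by exact_mod_cast hj
  have hm' : (0 : ℝ) < m := by exact_mod_cast hm
  have hconv := Real.convexOn_log_Gamma
  have hup := hconv.slope_mono_adjacent (x := (j : ℝ) + m / 2 + 1) (y := j + m + 1)
    (z := j + m + 1 + 1) (by simp; positivity) (by simp; positivity) (by linarith) (by linarith)
  have hlo := hconv.slope_mono_adjacent (x := (j : ℝ)) (y := j + 1)
    (z := j + m / 2 + 1) (by simpa using hj) (by simp; positivity) (by linarith) (by linarith)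
  have hΓ1 : 0 < Real.Gamma (j + m + 1) := Real.Gamma_pos_of_pos (by positivity)
  have hΓ0 : 0 < Real.Gamma j := Real.Gamma_pos_of_pos hj'
  have hΓ : 0 < Real.Gamma (j + m / 2 + 1) := Real.Gamma_pos_of_pos (by positivity)
  have hΓj : 0 < Real.Gamma (j + 1) := Real.Gamma_pos_of_pos (by positivity)
  have e1 : (j : ℝ) + m + 1 - (j + m / 2 + 1) = m / 2 := by ring
  have e2 : (j : ℝ) + m / 2 + 1 - (j + 1) = m / 2 := by ring
  simp only [Function.comp_apply, add_sub_cancel_left, div_one, e1, e2] at hup hlo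
  rw [Real.Gamma_add_one (by positivity : (j : ℝ) + m + 1 ≠ 0),
    Real.log_mul (by positivity) hΓ1.ne', div_le_iff₀ (by positivity)] at hup
  rw [le_div_iff₀ (by positivity)] at hlo
  have hlogj : Real.log (Real.Gamma (j + 1)) = Real.log j + Real.log (Real.Gamma j) := by
    rw [Real.Gamma_add_one hj'.ne', Real.log_mul hj'.ne' hΓ0.ne']
  have hr : Real.log (gammaRatio m j) = 2 * Real.log (Real.Gamma (j + m / 2 + 1)) -
      (Real.log (Real.Gamma (j + 1)) + Real.log (Real.Gamma (j + m + 1))) := by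
    have : ((j : ℝ) + m + 1) = ((j + m : ℕ) : ℝ) + 1 := by push_cast; ring
    rw [gammaRatio, Real.log_div (by positivity) (by positivity), Real.log_pow,
      Real.log_mul (by positivity) (by positivity), this, Real.Gamma_nat_eq_factorial,
      Real.Gamma_nat_eq_factorial]
    push_cast
    ring
  rw [hr]
  nlinarith

/-- Log-convexity at the midpoint of `j + 1` and `j + m + 1`. -/
theorem gammaRatio_le_one (m j : ℕ) : gammaRatio m j ≤ 1 := by
  have hx : (j : ℝ) + 1 ∈ Set.Ioi (0 : ℝ) := by simp; positivity
  have hy : ((j + m : ℕ) : ℝ) + 1 ∈ Set.Ioi (0 : ℝ) := by simp; positivity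
  have h := Real.convexOn_log_Gamma.2 hx hy (show (0 : ℝ) ≤ 1 / 2 by norm_num)
    (show (0 : ℝ) ≤ 1 / 2 by norm_num) (by norm_num)
  have hmid : (1 / 2 : ℝ) * ((j : ℝ) + 1) + 1 / 2 * (((j + m : ℕ) : ℝ) + 1) = j + m / 2 + 1 := by
    push_cast; ring
  simp only [smul_eq_mul, Function.comp_apply, hmid, Real.Gamma_nat_eq_factorial] at h
  have hΓ : 0 < Real.Gamma (j + m / 2 + 1) := Real.Gamma_pos_of_pos (by positivity)
  rw [gammaRatio, div_le_one (by positivity)]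
  rw [← Real.log_le_log_iff (by positivity) (by positivity), Real.log_pow,
    Real.log_mul (by positivity) (by positivity)]
  push_cast
  linarith

theorem tendsto_gammaRatio (m : ℕ) : Tendsto (gammaRatio m) atTop (nhds 1) := by
  have hlog : Tendsto (fun j : ℕ => (m : ℝ) / 2 * (Real.log (j + (m + 1)) - Real.log j)) atTop
      (nhds 0) := by
    have h := ((Real.tendsto_log_comp_add_sub_log (m + 1 : ℝ)).comp
      tendsto_natCast_atTop_atTop).const_mul ((m : ℝ) / 2)
    simpa using h
  have hexp := (Real.continuous_exp.tendsto _).comp hlog.neg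
  simp only [neg_zero, Real.exp_zero] at hexp
  refine tendsto_of_tendsto_of_tendsto_of_le_of_le' hexp tendsto_const_nhds ?_
    (Eventually.of_forall fun j => gammaRatio_le_one m j)
  filter_upwards [eventually_gt_atTop 0] with j hj
  have h := neg_log_gammaRatio_le m j hj
  rw [Function.comp_apply, ← Real.le_log_iff_exp_le (gammaRatio_pos m j), ← add_assoc]
  linarith

/-- Since the recursion gives `r(j+1) - r(j) ≤ (m²/4)/((j+1)(j+2))` for `r = gammaRatio m` and
`m ≥ 1`, the sequence `r(j) + (m²/4)/(j+1)` decreases to its limit `1`. -/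
theorem one_sub_gammaRatio_le (m j : ℕ) :
    1 - gammaRatio m j ≤ (m : ℝ) ^ 2 / 4 / (j + 1) := by
  rcases Nat.eq_zero_or_pos m with rfl | hm
  · simp [gammaRatio_zero]
  have hm' : (1 : ℝ) ≤ m := by exact_mod_cast hm
  have hanti : Antitone fun i : ℕ => gammaRatio m i + (m : ℝ) ^ 2 / 4 / (i + 1) := by
    refine antitone_nat_of_succ_le fun i => ?_
    have h1 : gammaRatio m i * ((m : ℝ) ^ 2 / 4 / ((i + 1) * (i + 1 + m))) ≤
        1 * ((m : ℝ) ^ 2 / 4 / ((i + 1) * (i + 1 + 1))) := by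
      gcongr
      exact gammaRatio_le_one m i
    have h2 : (m : ℝ) ^ 2 / 4 / (i + 1) - (m : ℝ) ^ 2 / 4 / ((i + 1 : ℕ) + 1) =
        (m : ℝ) ^ 2 / 4 / ((i + 1) * (i + 1 + 1)) := by
      push_cast
      field_simp
      ring
    rw [gammaRatio_succ]
    linarith
  have hlim : Tendsto (fun i : ℕ => gammaRatio m i + (m : ℝ) ^ 2 / 4 / (i + 1)) atTop
      (nhds (1 + 0)) :=
    (tendsto_gammaRatio m).add
      (tendsto_const_nhds.div_atTop (tendsto_natCast_atTop_atTop.atTop_add tendsto_const_nhds))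
  have := hanti.le_of_tendsto hlim j
  linarith

/-- For `r = gammaRatio m`, the sequence `r(j) (1 + (m²/4)/(j+1+m))` increases to its limit `1`. -/
theorem le_one_sub_gammaRatio (m j : ℕ) :
    (m : ℝ) ^ 2 / 4 / (j + 1 + m + (m : ℝ) ^ 2 / 4) ≤ 1 - gammaRatio m j := by
  have hmono : Monotone fun i : ℕ => gammaRatio m i * (1 + (m : ℝ) ^ 2 / 4 / (i + 1 + m)) := by
    refine monotone_nat_of_le_succ fun i => ?_
    rw [gammaRatio_succ, mul_assoc]
    refine mul_le_mul_of_nonneg_left ?_ (gammaRatio_pos m i).le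
    have h1 : (m : ℝ) ^ 2 / 4 / ((i + 1 + m) * (i + 2 + m)) ≤
        (m : ℝ) ^ 2 / 4 / ((i + 1) * (i + 1 + m)) := by
      apply div_le_div_of_nonneg_left (by positivity) (by positivity)
      nlinarith [(Nat.cast_nonneg m : (0 : ℝ) ≤ m), (Nat.cast_nonneg i : (0 : ℝ) ≤ i)]
    have h2 : (m : ℝ) ^ 2 / 4 / (i + 1 + m) =
        (m : ℝ) ^ 2 / 4 / ((i + 1 + m) * (i + 2 + m)) + (m : ℝ) ^ 2 / 4 / (i + 2 + m) := by
      field_simp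
      ring
    have h3 : 0 ≤ (m : ℝ) ^ 2 / 4 / ((i + 1) * (i + 1 + m)) * ((m : ℝ) ^ 2 / 4 / (i + 2 + m)) := by
      positivity
    have h4 : (((i + 1 : ℕ) : ℝ) + 1 + m) = i + 2 + m := by push_cast; ring
    rw [h4]
    nlinarith
  have hlim : Tendsto (fun i : ℕ => gammaRatio m i * (1 + (m : ℝ) ^ 2 / 4 / (i + 1 + m))) atTop
      (nhds (1 * (1 + 0))) := by
    refine (tendsto_gammaRatio m).mul (tendsto_const_nhds.add (tendsto_const_nhds.div_atTop ?_))
    exact (tendsto_natCast_atTop_atTop.atTop_add tendsto_const_nhds).atTop_add tendsto_const_nhds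
  have h := hmono.ge_of_tendsto hlim j
  simp only [add_zero, mul_one] at h
  have hd : (0 : ℝ) < j + 1 + m := by positivity
  have h' : gammaRatio m j * (j + 1 + m + (m : ℝ) ^ 2 / 4) ≤ j + 1 + m := by
    have := mul_le_mul_of_nonneg_right h hd.le
    rw [mul_assoc, one_mul, add_mul, div_mul_cancel₀ _ hd.ne', one_mul] at this
    exact this
  rw [div_le_iff₀ (by positivity)]
  nlinarith

/-! ### The variance coefficients -/

/-- The coefficient `N - ∑_{j < N - m} Γ(j + m/2 + 1)² / (j! (j + m)!)` of the frequencies `± m` in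
the covariance of phase statistics. -/
noncomputable def covCoeff (N m : ℕ) : ℝ := N - ∑ j ∈ Finset.range (N - m), gammaRatio m j

theorem covCoeff_eq (N m : ℕ) :
    covCoeff N m = (min N m : ℕ) + ∑ j ∈ Finset.range (N - m), (1 - gammaRatio m j) := by
  have h : (N : ℝ) = (min N m : ℕ) + (N - m : ℕ) := by
    rw [← Nat.cast_add]; congr 1; omega
  rw [covCoeff, Finset.sum_sub_distrib, Finset.sum_const, Finset.card_range, nsmul_eq_mul, mul_one]
  linarith

theorem covCoeff_nonneg (N m : ℕ) : 0 ≤ covCoeff N m := by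
  rw [covCoeff_eq]
  exact add_nonneg (Nat.cast_nonneg _)
    (Finset.sum_nonneg fun j _ => sub_nonneg.2 (gammaRatio_le_one m j))

/-- The harmonic sum of `(m²/4)/(j+1)` gives the logarithm. -/
theorem covCoeff_le (N m : ℕ) :
    covCoeff N m ≤ (m : ℝ) ^ 2 / 4 * Real.log N + 5 / 4 * (m : ℝ) ^ 2 := by
  have h1 : ∑ j ∈ Finset.range (N - m), (1 - gammaRatio m j) ≤
      (m : ℝ) ^ 2 / 4 * (1 + Real.log N) := by
    calc ∑ j ∈ Finset.range (N - m), (1 - gammaRatio m j)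
        ≤ ∑ j ∈ Finset.range N, (1 - gammaRatio m j) :=
          Finset.sum_le_sum_of_subset_of_nonneg (Finset.range_mono (Nat.sub_le _ _))
            fun j _ _ => sub_nonneg.2 (gammaRatio_le_one m j)
      _ ≤ ∑ j ∈ Finset.range N, (m : ℝ) ^ 2 / 4 * ((j + 1 : ℝ))⁻¹ :=
          Finset.sum_le_sum fun j _ => one_sub_gammaRatio_le m j
      _ = (m : ℝ) ^ 2 / 4 * (harmonic N : ℝ) := by
          rw [← Finset.mul_sum]
          simp [harmonic]
      _ ≤ _ := by gcongr; exact harmonic_le_one_add_log N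
  have h2 : ((min N m : ℕ) : ℝ) ≤ (m : ℝ) ^ 2 := by
    have : min N m ≤ m ^ 2 := (min_le_right _ _).trans (Nat.le_self_pow two_ne_zero m)
    exact_mod_cast this
  rw [covCoeff_eq]
  linarith

/-- A lower bound of a shifted harmonic sum by the logarithm. -/
theorem log_sub_log_le_sum_inv (n : ℕ) {D : ℝ} (hD : 0 ≤ D) :
    Real.log (n + 1 + D) - Real.log (1 + D) ≤ ∑ j ∈ Finset.range n, (j + 1 + D : ℝ)⁻¹ := by
  induction n with
  | zero => simp
  | succ n ih =>
    rw [Finset.sum_range_succ]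
    have hp : (0 : ℝ) < n + 1 + D := by positivity
    have h : Real.log ((n + 1 : ℕ) + 1 + D) - Real.log (n + 1 + D) ≤ (n + 1 + D : ℝ)⁻¹ := by
      rw [← Real.log_div (by positivity) hp.ne']
      refine (Real.log_le_sub_one_of_pos (by positivity)).trans_eq ?_
      push_cast
      field_simp
      ring
    linarith

/-- For `m ≥ N` the left side is nonpositive, because then `N ≤ (1 + m/2)²`. -/
theorem le_covCoeff (N m : ℕ) (hN : 1 ≤ N) :
    (m : ℝ) ^ 2 / 4 * (Real.log N - 2 * Real.log (1 + m / 2)) ≤ covCoeff N m := by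
  have hN' : (0 : ℝ) < N := by exact_mod_cast hN
  -- The shift `1 + m + m²/4` in the lower bound of `1 - gammaRatio m j` is a perfect square.
  have hsq : 2 * Real.log (1 + m / 2) = Real.log (1 + (m + (m : ℝ) ^ 2 / 4)) := by
    rw [show (1 + (m + (m : ℝ) ^ 2 / 4)) = (1 + m / 2) ^ 2 by ring, Real.log_pow]
    norm_num
  rcases le_total m N with h | h
  · have hs : (m : ℝ) ^ 2 / 4 * (Real.log N - 2 * Real.log (1 + m / 2)) ≤
        ∑ j ∈ Finset.range (N - m), (1 - gammaRatio m j) := by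
      calc _ ≤ (m : ℝ) ^ 2 / 4 * (Real.log ((N - m : ℕ) + 1 + (m + (m : ℝ) ^ 2 / 4)) -
              Real.log (1 + (m + (m : ℝ) ^ 2 / 4))) := by
            rw [hsq]
            gcongr
            rw [Nat.cast_sub h]
            have : (0 : ℝ) ≤ (m : ℝ) ^ 2 / 4 := by positivity
            linarith
        _ ≤ (m : ℝ) ^ 2 / 4 *
              ∑ j ∈ Finset.range (N - m), (j + 1 + (m + (m : ℝ) ^ 2 / 4) : ℝ)⁻¹ := by
            gcongr
            exact log_sub_log_le_sum_inv _ (by positivity)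
        _ ≤ _ := by
            rw [Finset.mul_sum]
            refine Finset.sum_le_sum fun j _ => ?_
            rw [← div_eq_mul_inv, ← add_assoc]
            exact le_one_sub_gammaRatio m j
    rw [covCoeff_eq]
    exact hs.trans (le_add_of_nonneg_left (Nat.cast_nonneg _))
  · refine le_trans (mul_nonpos_of_nonneg_of_nonpos (by positivity) ?_) (covCoeff_nonneg N m)
    rw [hsq, sub_nonpos]
    have : (N : ℝ) ≤ m := by exact_mod_cast h
    apply Real.log_le_log hN'
    nlinarith [sq_nonneg (m : ℝ)]

/-- The expansion of the coefficients, with an error that is uniform in `N`. -/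
theorem abs_covCoeff_sub_le (N m : ℕ) (hN : 1 ≤ N) :
    |covCoeff N m - (m : ℝ) ^ 2 / 4 * Real.log N| ≤
      (m : ℝ) ^ 2 * (5 / 4 + Real.log (1 + m / 2)) := by
  have h1 := covCoeff_le N m
  have h2 := le_covCoeff N m hN
  have h3 : 0 ≤ (m : ℝ) ^ 2 * Real.log (1 + m / 2) :=
    mul_nonneg (by positivity) (Real.log_nonneg (le_add_of_nonneg_right (by positivity)))
  have h4 : 0 ≤ (m : ℝ) ^ 2 := by positivity
  rw [abs_le]
  constructor <;> nlinarith

/-- A crude bound on the error, of the order of the main term. -/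
theorem abs_covCoeff_sub_le_log (N m : ℕ) (hN : 3 ≤ N) :
    |covCoeff N m - (m : ℝ) ^ 2 / 4 * Real.log N| ≤ 5 / 4 * (m : ℝ) ^ 2 * Real.log N := by
  have h1 := covCoeff_le N m
  have h2 := covCoeff_nonneg N m
  have hlog : 1 ≤ Real.log N := by
    rw [Real.le_log_iff_exp_le (by positivity)]
    have : (3 : ℝ) ≤ N := by exact_mod_cast hN
    linarith [Real.exp_one_lt_d9]
  have h4 : 0 ≤ (m : ℝ) ^ 2 := by positivity
  rw [abs_le]
  constructor <;> nlinarith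

/-! ### Linear statistics of biorthogonal ensembles -/

section Biorthogonal

variable {α ι : Type*} [MeasurableSpace α] [Fintype ι] [DecidableEq ι]

/-- The product of the determinants of `φ` and `ψ` at the configuration `z`: up to normalization,
the density of the biorthogonal ensemble. -/
noncomputable def biorthDensity (φ ψ : ι → α → ℂ) (z : ι → α) : ℂ :=
  (Matrix.of fun a k => φ a (z k)).det * (Matrix.of fun b k => ψ b (z k)).det

/-- The matrix entries of the multiplication by `h` in the families `φ`, `ψ`. -/
noncomputable def mulEntry (μ : Measure α) (φ ψ : ι → α → ℂ) (h : α → ℂ) (a b : ι) : ℂ :=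
  ∫ x, h x * (φ a x * ψ b x) ∂μ

omit [MeasurableSpace α] in
theorem prod_mul_biorthDensity (φ ψ h : ι → α → ℂ) (z : ι → α) :
    (∏ k, h k (z k)) * biorthDensity φ ψ z =
      ∑ σ : Equiv.Perm ι, ∑ τ : Equiv.Perm ι, ((σ.sign : ℤ) : ℂ) * ((τ.sign : ℤ) : ℂ) *
        ∏ k, h k (z k) * (φ (σ k) (z k) * ψ (τ k) (z k)) := by
  rw [biorthDensity, Matrix.det_apply', Matrix.det_apply', Finset.sum_mul_sum, Finset.mul_sum]
  simp_rw [Finset.mul_sum]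
  simp only [Matrix.of_apply, Finset.prod_mul_distrib]
  refine Finset.sum_congr rfl fun σ _ => Finset.sum_congr rfl fun τ _ => ?_
  ring

variable {μ : Measure α} [SigmaFinite μ] {φ ψ : ι → α → ℂ}

theorem integrable_prod_mul_biorthDensity {h : ι → α → ℂ}
    (hint : ∀ k a b, Integrable (fun x => h k x * (φ a x * ψ b x)) μ) :
    Integrable (fun z : ι → α => (∏ k, h k (z k)) * biorthDensity φ ψ z)
      (Measure.pi fun _ => μ) := by
  simp_rw [prod_mul_biorthDensity]
  refine integrable_finsetSum _ fun σ _ => integrable_finsetSum _ fun τ _ =>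
    Integrable.const_mul ?_ _
  exact Integrable.fintype_prod fun k => hint k (σ k) (τ k)

/-- Andréief's identity, with one test function for each variable. -/
theorem integral_prod_mul_biorthDensity {h : ι → α → ℂ}
    (hint : ∀ k a b, Integrable (fun x => h k x * (φ a x * ψ b x)) μ) :
    ∫ z : ι → α, (∏ k, h k (z k)) * biorthDensity φ ψ z ∂(Measure.pi fun _ => μ) =
      ∑ σ : Equiv.Perm ι, (Matrix.of fun l k => mulEntry μ φ ψ (h k) (σ k) (σ l)).det := by
  -- Substituting `σ τ` for `τ` turns the inner sum over `τ` into a determinant.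
  simp_rw [prod_mul_biorthDensity]
  have hi : ∀ σ τ : Equiv.Perm ι, Integrable (fun z : ι → α =>
      ((σ.sign : ℤ) : ℂ) * ((τ.sign : ℤ) : ℂ) *
        ∏ k, h k (z k) * (φ (σ k) (z k) * ψ (τ k) (z k))) (Measure.pi fun _ => μ) := fun σ τ =>
    Integrable.const_mul (Integrable.fintype_prod
      (f := fun k x => h k x * (φ (σ k) x * ψ (τ k) x)) fun k => hint k (σ k) (τ k)) _
  rw [integral_finsetSum _ fun σ _ => integrable_finsetSum _ fun τ _ => hi σ τ]
  refine Finset.sum_congr rfl fun σ _ => ?_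
  rw [integral_finsetSum _ fun τ _ => hi σ τ, Matrix.det_apply',
    ← Equiv.sum_comp (Equiv.mulLeft σ)]
  refine Finset.sum_congr rfl fun τ _ => ?_
  rw [integral_const_mul, integral_fintype_prod_eq_prod
    (fun k x => h k x * (φ (σ k) x * ψ ((Equiv.mulLeft σ τ) k) x))]
  congr 1
  rw [Equiv.coe_mulLeft, Equiv.Perm.sign_mul, Units.val_mul, Int.cast_mul, ← mul_assoc,
    ← Int.cast_mul, ← Units.val_mul, Int.units_mul_self]
  simp

/-- The determinant of the identity matrix with two columns replaced. -/
theorem det_one_two_columns {k l : ι} (hkl : k ≠ l) (u v : ι → ℂ) :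
    (Matrix.of fun i j =>
      if j = k then u i else if j = l then v i else (1 : Matrix ι ι ℂ) i j).det =
      u k * v l - u l * v k := by
  -- The matrix is a perturbation of the identity of rank two, so that the Weinstein–Aronszajn
  -- identity reduces its determinant to a two-by-two one.
  let e : ι → ι → ℂ := fun j i => if i = j then 1 else 0
  let U : Matrix ι (Fin 2) ℂ := Matrix.of fun i s => ![u i - e k i, v i - e l i] s
  let V : Matrix (Fin 2) ι ℂ := Matrix.of fun s j => ![e k j, e l j] s
  have h : (Matrix.of fun i j =>
      if j = k then u i else if j = l then v i else (1 : Matrix ι ι ℂ) i j) = 1 + U * V := by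
    ext i j
    by_cases h1 : j = k
    · subst h1
      simp [Matrix.mul_apply, U, V, e, Matrix.one_apply, hkl]
    · by_cases h2 : j = l
      · subst h2
        simp [Matrix.mul_apply, U, V, e, Matrix.one_apply, hkl.symm]
      · simp [Matrix.mul_apply, U, V, e, h1, h2]
  have h11 : ∀ s t, (V * U) s t = ![![u k - 1, v k], ![u l, v l - 1]] s t := by
    intro s t
    fin_cases s <;> fin_cases t <;>
      simp [Matrix.mul_apply, U, V, e, hkl, hkl.symm]
  rw [h, Matrix.det_one_add_mul_comm, Matrix.det_fin_two]
  simp [h11]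
  ring

/-- The determinant of the identity matrix with one column replaced. -/
theorem det_one_one_column (k : ι) (u : ι → ℂ) :
    (Matrix.of fun i j => if j = k then u i else (1 : Matrix ι ι ℂ) i j).det = u k := by
  have h : (Matrix.of fun i j => if j = k then u i else (1 : Matrix ι ι ℂ) i j) =
      (1 : Matrix ι ι ℂ).updateCol k u := by
    ext i j
    simp [Matrix.updateCol_apply]
  rw [h, ← Matrix.cramer_apply, Matrix.cramer_one]
  rfl

section Moments

variable (hφψ : ∀ a b, Integrable (fun x => φ a x * ψ b x) μ)
  (horth : ∀ a b, ∫ x, φ a x * ψ b x ∂μ = if a = b then 1 else 0)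

include hφψ in
theorem integrable_biorthDensity :
    Integrable (biorthDensity φ ψ) (Measure.pi fun _ : ι => μ) := by
  have := integrable_prod_mul_biorthDensity (h := fun (_ : ι) (_ : α) => (1 : ℂ))
    (μ := μ) (φ := φ) (ψ := ψ) (fun _ => by simpa using hφψ)
  simpa using this

include hφψ horth in
theorem integral_biorthDensity :
    ∫ z, biorthDensity φ ψ z ∂(Measure.pi fun _ : ι => μ) = (Fintype.card ι).factorial := by
  have := integral_prod_mul_biorthDensity (h := fun (_ : ι) (_ : α) => (1 : ℂ))
    (μ := μ) (φ := φ) (ψ := ψ) (fun _ => by simpa using hφψ)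
  have hone : (Matrix.of fun l k : ι => if k = l then (1 : ℂ) else 0) = 1 := by
    ext l k
    simp [Matrix.one_apply, eq_comm]
  simpa [mulEntry, horth, hone, Fintype.card_perm] using this

include hφψ horth in
/-- The first correlation function, before averaging over the permutations. -/
theorem integral_mul_biorthDensity {F : α → ℂ}
    (hF : ∀ a b, Integrable (fun x => F x * (φ a x * ψ b x)) μ) (k : ι) :
    ∫ z, F (z k) * biorthDensity φ ψ z ∂(Measure.pi fun _ : ι => μ) =
      ∑ σ : Equiv.Perm ι, mulEntry μ φ ψ F (σ k) (σ k) := by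
  have := integral_prod_mul_biorthDensity (h := fun (i : ι) (x : α) => if i = k then F x else 1)
    (μ := μ) (φ := φ) (ψ := ψ) (fun i a b => by split_ifs <;> simp [hF, hφψ])
  simp only [Finset.prod_ite_eq', Finset.mem_univ, if_true] at this
  rw [this]
  refine Finset.sum_congr rfl fun σ _ => ?_
  rw [← det_one_one_column k fun l => mulEntry μ φ ψ F (σ k) (σ l)]
  congr 1
  ext l j
  by_cases hj : j = k
  · simp [hj]
  · simp [hj, mulEntry, horth, Matrix.one_apply, eq_comm (a := l)]

include hφψ horth in
/-- The second correlation function, before averaging over the permutations. The two-by-two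
determinant vanishes for `k = l`, where only the product `F G` contributes. -/
theorem integral_mul_mul_biorthDensity {F G : α → ℂ}
    (hF : ∀ a b, Integrable (fun x => F x * (φ a x * ψ b x)) μ)
    (hG : ∀ a b, Integrable (fun x => G x * (φ a x * ψ b x)) μ)
    (hFG : ∀ a b, Integrable (fun x => F x * G x * (φ a x * ψ b x)) μ) (k l : ι) :
    ∫ z, F (z k) * G (z l) * biorthDensity φ ψ z ∂(Measure.pi fun _ : ι => μ) =
      ∑ σ : Equiv.Perm ι,
        ((if σ k = σ l then mulEntry μ φ ψ (fun x => F x * G x) (σ k) (σ k) else 0) +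
        (mulEntry μ φ ψ F (σ k) (σ k) * mulEntry μ φ ψ G (σ l) (σ l) -
          mulEntry μ φ ψ F (σ k) (σ l) * mulEntry μ φ ψ G (σ l) (σ k))) := by
  by_cases hkl : k = l
  · subst hkl
    rw [integral_mul_biorthDensity hφψ horth hFG k]
    simp
  have := integral_prod_mul_biorthDensity
    (h := fun (i : ι) (x : α) => (if i = k then F x else 1) * (if i = l then G x else 1))
    (μ := μ) (φ := φ) (ψ := ψ) (fun i a b => by
      split_ifs <;> simp only [one_mul, mul_one, hF, hG, hFG, hφψ])
  simp only [Finset.prod_mul_distrib, Finset.prod_ite_eq', Finset.mem_univ, if_true] at this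
  rw [this]
  refine Finset.sum_congr rfl fun σ _ => ?_
  rw [if_neg (σ.injective.ne hkl), zero_add,
    ← det_one_two_columns hkl (fun i => mulEntry μ φ ψ F (σ k) (σ i))
      fun i => mulEntry μ φ ψ G (σ l) (σ i)]
  congr 1
  ext i j
  by_cases hj : j = k
  · subst hj
    simp [hkl]
  · by_cases hj' : j = l
    · simp [hj', Ne.symm hkl]
    · simp [hj, hj', mulEntry, horth, Matrix.one_apply, eq_comm (a := i)]

include hφψ in
theorem integrable_mul_biorthDensity {F : α → ℂ}
    (hF : ∀ a b, Integrable (fun x => F x * (φ a x * ψ b x)) μ) (k : ι) :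
    Integrable (fun z : ι → α => F (z k) * biorthDensity φ ψ z) (Measure.pi fun _ => μ) := by
  have := integrable_prod_mul_biorthDensity
    (h := fun (i : ι) (x : α) => if i = k then F x else 1)
    (μ := μ) (φ := φ) (ψ := ψ) (fun i a b => by split_ifs <;> simp [hF, hφψ])
  simpa only [Finset.prod_ite_eq', Finset.mem_univ, if_true] using this

include hφψ in
theorem integrable_mul_mul_biorthDensity {F G : α → ℂ}
    (hF : ∀ a b, Integrable (fun x => F x * (φ a x * ψ b x)) μ)
    (hG : ∀ a b, Integrable (fun x => G x * (φ a x * ψ b x)) μ)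
    (hFG : ∀ a b, Integrable (fun x => F x * G x * (φ a x * ψ b x)) μ) (k l : ι) :
    Integrable (fun z : ι → α => F (z k) * G (z l) * biorthDensity φ ψ z)
      (Measure.pi fun _ => μ) := by
  have := integrable_prod_mul_biorthDensity
    (h := fun (i : ι) (x : α) => (if i = k then F x else 1) * (if i = l then G x else 1))
    (μ := μ) (φ := φ) (ψ := ψ) (fun i a b => by
      split_ifs <;> simp only [one_mul, mul_one, hF, hG, hFG, hφψ])
  simpa only [Finset.prod_mul_distrib, Finset.prod_ite_eq', Finset.mem_univ, if_true] using this

/-- Every permutation merely relabels the indices of a double sum. -/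
theorem sum_perm_sum_apply (t : ι → ι → ℂ) :
    ∑ k, ∑ l, ∑ σ : Equiv.Perm ι, t (σ k) (σ l) =
      (Fintype.card ι).factorial * ∑ a, ∑ b, t a b := by
  have h : ∀ σ : Equiv.Perm ι, ∑ k, ∑ l, t (σ k) (σ l) = ∑ a, ∑ b, t a b := fun σ => by
    rw [← Equiv.sum_comp σ fun a => ∑ b, t a b]
    exact Finset.sum_congr rfl fun k _ => Equiv.sum_comp σ (t (σ k))
  simp_rw [Finset.sum_comm (s := Finset.univ (α := ι)) (t := Finset.univ (α := Equiv.Perm ι))]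
  simp [h, Fintype.card_perm]

include hφψ horth in
theorem integral_sum_mul_biorthDensity {F : α → ℂ}
    (hF : ∀ a b, Integrable (fun x => F x * (φ a x * ψ b x)) μ) :
    ∫ z, (∑ k, F (z k)) * biorthDensity φ ψ z ∂(Measure.pi fun _ : ι => μ) =
      (Fintype.card ι).factorial * ∑ a, mulEntry μ φ ψ F a a := by
  simp_rw [Finset.sum_mul]
  rw [integral_finsetSum _ fun k _ => integrable_mul_biorthDensity hφψ hF k]
  simp_rw [integral_mul_biorthDensity hφψ horth hF]
  rw [Finset.sum_comm]
  have h : ∀ σ : Equiv.Perm ι, ∑ k, mulEntry μ φ ψ F (σ k) (σ k) = ∑ a, mulEntry μ φ ψ F a a :=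
    fun σ => Equiv.sum_comp σ fun a => mulEntry μ φ ψ F a a
  simp [h, Fintype.card_perm]

include hφψ horth in
/-- The unnormalized second moments of linear statistics. Subtracting the product of the means
leaves `tr (F G) - ∑ₐ ∑_b F_ab G_ba` for the covariance. -/
theorem integral_sum_mul_sum_mul_biorthDensity {F G : α → ℂ}
    (hF : ∀ a b, Integrable (fun x => F x * (φ a x * ψ b x)) μ)
    (hG : ∀ a b, Integrable (fun x => G x * (φ a x * ψ b x)) μ)
    (hFG : ∀ a b, Integrable (fun x => F x * G x * (φ a x * ψ b x)) μ) :
    ∫ z, (∑ k, F (z k)) * (∑ l, G (z l)) * biorthDensity φ ψ z ∂(Measure.pi fun _ : ι => μ) =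
      (Fintype.card ι).factorial * (∑ a, mulEntry μ φ ψ (fun x => F x * G x) a a +
        ((∑ a, mulEntry μ φ ψ F a a) * (∑ b, mulEntry μ φ ψ G b b) -
          ∑ a, ∑ b, mulEntry μ φ ψ F a b * mulEntry μ φ ψ G b a)) := by
  have hFGi := integrable_mul_mul_biorthDensity hφψ hF hG hFG
  simp_rw [Finset.sum_mul_sum, Finset.sum_mul]
  rw [integral_finsetSum _ fun k _ => integrable_finsetSum _ fun l _ => hFGi k l]
  simp_rw [integral_finsetSum Finset.univ fun l _ => hFGi _ l,
    integral_mul_mul_biorthDensity hφψ horth hF hG hFG]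
  rw [sum_perm_sum_apply fun a b =>
    (if a = b then mulEntry μ φ ψ (fun x => F x * G x) a a else 0) +
      (mulEntry μ φ ψ F a a * mulEntry μ φ ψ G b b - mulEntry μ φ ψ F a b * mulEntry μ φ ψ G b a)]
  simp [Finset.sum_add_distrib, Finset.sum_sub_distrib]

end Moments

end Biorthogonal

/-! ### Fourier series on the circle -/

/-- The continuous linear functional `φ ↦ ∫ φ h` on continuous functions. -/
noncomputable def circPairing {h : Circ → ℂ} (hh : Integrable h circMeasure) : C(Circ, ℂ) →L[ℂ] ℂ :=
  LinearMap.mkContinuous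
    { toFun := fun φ => ∫ x, φ x * h x ∂circMeasure
      map_add' := fun φ χ => by
        have hi : ∀ φ : C(Circ, ℂ), Integrable (fun x => φ x * h x) circMeasure := fun φ =>
          hh.bdd_mul (c := ‖φ‖) φ.continuous.aestronglyMeasurable
            (Eventually.of_forall φ.norm_coe_le_norm)
        simp only [ContinuousMap.add_apply, add_mul]
        exact integral_add (hi φ) (hi χ)
      map_smul' := fun c φ => by
        simp only [ContinuousMap.smul_apply, smul_eq_mul, mul_assoc, RingHom.id_apply]
        exact integral_const_mul _ _ }
    (∫ x, ‖h x‖ ∂circMeasure) fun φ => by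
      rw [mul_comm (∫ x, ‖h x‖ ∂circMeasure), ← integral_const_mul]
      refine norm_integral_le_of_norm_le (hh.norm.const_mul _) (Eventually.of_forall fun x => ?_)
      rw [norm_mul]
      exact mul_le_mul_of_nonneg_right (φ.norm_coe_le_norm x) (norm_nonneg _)

theorem circPairing_apply {h : Circ → ℂ} (hh : Integrable h circMeasure) (φ : C(Circ, ℂ)) :
    circPairing hh φ = ∫ x, φ x * h x ∂circMeasure := rfl

theorem circPairing_fourier {h : Circ → ℂ} (hh : Integrable h circMeasure) (n : ℤ) :
    circPairing hh (fourier n) = fourierCoeff h (-n) := by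
  simp [circPairing_apply, fourierCoeff]

/-- Uniqueness of Fourier coefficients for integrable functions. -/
theorem ae_eq_zero_of_fourierCoeff_eq_zero {h : Circ → ℂ} (hh : Integrable h circMeasure)
    (h0 : ∀ n, fourierCoeff h n = 0) : h =ᵐ[circMeasure] 0 := by
  -- Trigonometric polynomials are dense, so `h` annihilates the continuous functions, hence also
  -- the indicators of closed sets.
  have hker : ∀ φ : C(Circ, ℂ), ∫ x, φ x * h x ∂circMeasure = 0 := by
    have hle : (Submodule.span ℂ (Set.range (@fourier (2 * π)))).topologicalClosure ≤
        LinearMap.ker (circPairing hh).toLinearMap := by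
      refine Submodule.topologicalClosure_minimal _ ?_ (circPairing hh).isClosed_ker
      rw [Submodule.span_le]
      rintro _ ⟨n, rfl⟩
      exact (circPairing_fourier hh n).trans (h0 _)
    rw [span_fourier_closure_eq_top] at hle
    exact fun φ => hle (Submodule.mem_top (x := φ))
  refine ae_eq_zero_of_forall_setIntegral_isClosed_eq_zero hh fun s hs => ?_
  have happ : ∀ n x, ‖((hs.apprSeq n x : ℝ) : ℂ)‖ ≤ 1 := fun n x => by
    rw [Complex.norm_real, NNReal.norm_eq]
    exact_mod_cast HasOuterApproxClosed.apprSeq_apply_le_one hs n x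
  have hcont : ∀ n, Continuous fun x => ((hs.apprSeq n x : ℝ) : ℂ) := fun n =>
    Complex.continuous_ofReal.comp (NNReal.continuous_coe.comp (hs.apprSeq n).continuous)
  have hlim := tendsto_integral_of_dominated_convergence (μ := circMeasure)
    (F := fun n x => ((hs.apprSeq n x : ℝ) : ℂ) * h x) (f := s.indicator h) (fun x => ‖h x‖)
    (fun n => (hcont n).aestronglyMeasurable.mul hh.1) hh.norm
    (fun n => Eventually.of_forall fun x => by
      rw [norm_mul]
      exact mul_le_of_le_one_left (norm_nonneg _) (happ n x))
    (Eventually.of_forall fun x => by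
      have h1 := (tendsto_pi_nhds.1 (HasOuterApproxClosed.tendsto_apprSeq hs)) x
      have h2 := ((Complex.continuous_ofReal.comp NNReal.continuous_coe).tendsto _).comp h1
      have h3 := h2.mul_const (h x)
      by_cases hx : x ∈ s <;> simpa [Function.comp_def, hx] using h3)
  rw [integral_indicator hs.measurableSet] at hlim
  refine tendsto_nhds_unique hlim ?_
  have : ∀ n, ∫ x, ((hs.apprSeq n x : ℝ) : ℂ) * h x ∂circMeasure = 0 := fun n =>
    hker ⟨_, hcont n⟩
  simp [this]

theorem ae_eq_of_fourierCoeff_eq {f h : Circ → ℂ} (hf : Integrable f circMeasure)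
    (hh : Integrable h circMeasure) (hfh : ∀ n, fourierCoeff f n = fourierCoeff h n) :
    f =ᵐ[circMeasure] h := by
  have hadd := fourierCoeff.add (hf.sub hh) hh
  rw [sub_add_cancel] at hadd
  have h0 := ae_eq_zero_of_fourierCoeff_eq_zero (hf.sub hh) fun n => by
    have := congrFun hadd n
    rw [Pi.add_apply, hfh] at this
    simpa using this
  filter_upwards [h0] with x hx
  exact sub_eq_zero.1 hx

/-- Riesz–Fischer. -/
theorem exists_memLp_fourierCoeff_eq {c : ℤ → ℂ} (hc : Summable fun n => ‖c n‖ ^ 2) :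
    ∃ h : Circ → ℂ, MemLp h 2 circMeasure ∧ ∀ n, fourierCoeff h n = c n := by
  have hmem : Memℓp c 2 := memℓp_gen (by simpa using hc)
  refine ⟨(fourierBasis (T := 2 * π)).repr.symm ⟨c, hmem⟩, Lp.memLp _, fun n => ?_⟩
  rw [← fourierBasis_repr, LinearIsometryEquiv.apply_symm_apply]

theorem MeasureTheory.MemLp.integrable_circ {f : Circ → ℂ} (hf : MemLp f 2 circMeasure) :
    Integrable f circMeasure :=
  hf.integrable (by norm_num)

theorem fourierCoeff_conj (f : Circ → ℂ) (n : ℤ) :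
    fourierCoeff (fun x => (starRingEnd ℂ) (f x)) n = (starRingEnd ℂ) (fourierCoeff f (-n)) := by
  rw [fourierCoeff, fourierCoeff, ← integral_conj]
  simp [-fourier_apply, fourier_neg]

/-- Parseval's identity in bilinear form. -/
theorem hasSum_fourierCoeff_mul {f g : Circ → ℂ} (hf : MemLp f 2 circMeasure)
    (hg : MemLp g 2 circMeasure) :
    HasSum (fun n => fourierCoeff f n * fourierCoeff g (-n)) (∫ x, f x * g x ∂circMeasure) := by
  have hf' : MemLp (fun x => (starRingEnd ℂ) (f x)) 2 circMeasure := hf.star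
  have hsum := (fourierBasis (T := 2 * π)).hasSum_inner_mul_inner (hf'.toLp _) (hg.toLp _)
  have hinner : inner ℂ (hf'.toLp _) (hg.toLp _) = ∫ x, f x * g x ∂circMeasure := by
    rw [L2.inner_def]
    refine integral_congr_ae ?_
    filter_upwards [hf'.coeFn_toLp, hg.coeFn_toLp] with x h1 h2
    rw [h1, h2, RCLike.inner_apply, Complex.conj_conj, mul_comm]
  rw [hinner, ← (Equiv.neg ℤ).hasSum_iff] at hsum
  refine (congrArg (fun u => HasSum u _) (funext fun n => ?_)).mpr hsum
  rw [Function.comp_apply, ← inner_conj_symm, ← HilbertBasis.repr_apply_apply,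
    ← HilbertBasis.repr_apply_apply, fourierBasis_repr, fourierBasis_repr,
    fourierCoeff_congr_ae hf'.coeFn_toLp, fourierCoeff_congr_ae hg.coeFn_toLp, fourierCoeff_conj]
  simp

/-- Square summability of `n f̂(n)` makes the Fourier coefficients summable. -/
theorem summable_fourierCoeff {f : Circ → ℂ}
    (hf : Summable fun k : ℤ => (k : ℝ) ^ 2 * ‖fourierCoeff f k‖ ^ 2) :
    Summable (fourierCoeff f) := by
  have h2 : Summable fun k : ℤ => 1 / (k : ℝ) ^ 2 :=
    Real.summable_one_div_int_pow.2 one_lt_two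
  refine Summable.of_norm_bounded_eventually (h2.add hf) ?_
  filter_upwards [(Set.finite_singleton (0 : ℤ)).compl_mem_cofinite] with k hk
  have hk' : (k : ℝ) ≠ 0 := by exact_mod_cast hk
  have h3 : ‖fourierCoeff f k‖ = |(k : ℝ)|⁻¹ * (|(k : ℝ)| * ‖fourierCoeff f k‖) := by
    rw [inv_mul_cancel_left₀ (abs_ne_zero.2 hk')]
  have h4 : (1 : ℝ) / (k : ℝ) ^ 2 = (|(k : ℝ)|⁻¹) ^ 2 := by simp
  have h5 : (k : ℝ) ^ 2 * ‖fourierCoeff f k‖ ^ 2 = (|(k : ℝ)| * ‖fourierCoeff f k‖) ^ 2 := by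
    rw [mul_pow, sq_abs]
  rw [h4, h5]
  nlinarith [sq_nonneg (|(k : ℝ)|⁻¹ - |(k : ℝ)| * ‖fourierCoeff f k‖),
    sq_nonneg (|(k : ℝ)|⁻¹), sq_nonneg (|(k : ℝ)| * ‖fourierCoeff f k‖)]

/-- A function with summable Fourier coefficients has a continuous representative. -/
theorem exists_continuous_ae_eq {f : Circ → ℂ} (hf : Integrable f circMeasure)
    (hs : Summable (fourierCoeff f)) : ∃ f₀ : C(Circ, ℂ), f =ᵐ[circMeasure] f₀ := by
  have hs' : Summable fun n : ℤ => fourierCoeff f n • (fourier n : C(Circ, ℂ)) := by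
    refine Summable.of_norm ?_
    simpa only [norm_smul, fourier_norm, mul_one] using hs.norm
  obtain ⟨f₀, hf₀⟩ := hs'
  refine ⟨f₀, ae_eq_of_fourierCoeff_eq hf
    (f₀.memLp circMeasure ℂ (p := 2)).integrable_circ fun n => ?_⟩
  have hi : Integrable (fourier (-n) : C(Circ, ℂ)) circMeasure :=
    ((fourier (-n) : C(Circ, ℂ)).memLp circMeasure ℂ (p := 2)).integrable_circ
  have h1 := hf₀.mapL (circPairing hi)
  have h2 : ∀ k, circPairing hi (fourierCoeff f k • (fourier k : C(Circ, ℂ))) =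
      if k = n then fourierCoeff f n else 0 := fun k => by
    rw [map_smul, circPairing_fourier, fourierCoeff_fourier, Pi.single_apply]
    by_cases hk : k = n <;> simp [hk]
  simp_rw [h2] at h1
  rw [(hasSum_ite_eq n (fourierCoeff f n)).unique h1, circPairing_apply, fourierCoeff]
  simp [mul_comm]

/-! ### Weak derivatives and Fourier coefficients -/

theorem intervalIntegral_eq_integral_circMeasure (F : Circ → ℂ) :
    ∫ θ in (-π)..π, F (θ : Circ) = (2 * π : ℝ) • ∫ x, F x ∂circMeasure := by
  have h := AddCircle.intervalIntegral_preimage (2 * π) (-π) F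
  rw [show -π + 2 * π = π by ring] at h
  rw [h, AddCircle.integral_haarAddCircle, smul_inv_smul₀ Real.two_pi_pos.ne']

theorem hasDerivAt_fourier_circ (n : ℤ) (x : ℝ) :
    HasDerivAt (fun y : ℝ => fourier (-n) (y : Circ))
      (-(Complex.I * n) * fourier (-n) (x : Circ)) x := by
  convert hasDerivAt_fourier_neg (2 * π) n x using 1
  have : (π : ℂ) ≠ 0 := by exact_mod_cast Real.pi_ne_zero
  push_cast
  field_simp

theorem contDiff_fourier_circ (n : ℤ) :
    ContDiff ℝ ∞ fun y : ℝ => (fourier n (y : Circ) : ℂ) := by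
  simp only [fourier_coe_apply]
  have h : ContDiff ℝ ∞ fun y : ℝ => (y : ℂ) := Complex.ofRealCLM.contDiff
  fun_prop

theorem periodic_coe_circ {β : Type*} (F : Circ → β) :
    Function.Periodic (fun y : ℝ => F (y : Circ)) (2 * π) := fun y => by
  simp only [AddCircle.coe_add_period]

/-- Test the weak derivative against the character `e^{-inθ}`. -/
theorem HasWeakDeriv.fourierCoeff_eq {f f' : Circ → ℂ} (h : HasWeakDeriv f f') (n : ℤ) :
    fourierCoeff f' n = Complex.I * n * fourierCoeff f n := by
  have h1 := h.2.2 _ (contDiff_fourier_circ (-n)) (periodic_coe_circ _)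
  simp_rw [(hasDerivAt_fourier_circ n _).deriv] at h1
  rw [intervalIntegral_eq_integral_circMeasure
      (fun x => f x * (-(Complex.I * n) * fourier (-n) x)),
    intervalIntegral_eq_integral_circMeasure (fun x => f' x * fourier (-n) x), ← smul_neg] at h1
  have h2 := smul_right_injective ℂ Real.two_pi_pos.ne' h1
  have h3 : ∀ x, f x * (-(Complex.I * n) * fourier (-n) x) =
      -(Complex.I * n) * (fourier (-n) x • f x) := fun x => by
    rw [smul_eq_mul]; ring
  have h4 : ∀ x, f' x * fourier (-n) x = fourier (-n) x • f' x := fun x => mul_comm _ _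
  simp_rw [h3, h4] at h2
  rw [integral_const_mul] at h2
  rw [fourierCoeff, fourierCoeff]
  linear_combination h2

theorem Function.Periodic.continuous_lift_circ {φ : ℝ → ℂ} (hp : Function.Periodic φ (2 * π))
    (hc : Continuous φ) : Continuous (hp.lift : Circ → ℂ) :=
  continuous_coinduced_dom.2 hc

/-- A classical derivative of a periodic function multiplies the Fourier coefficients by `i n`. -/
theorem fourierCoeff_lift_deriv {φ : ℝ → ℂ} (hφ : ContDiff ℝ ∞ φ)
    (hp : Function.Periodic φ (2 * π)) (hp' : Function.Periodic (deriv φ) (2 * π)) (n : ℤ) :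
    fourierCoeff (hp'.lift : Circ → ℂ) n = Complex.I * n * fourierCoeff (hp.lift : Circ → ℂ) n := by
  have hd : ∀ x, HasDerivAt φ (deriv φ x) x := fun x =>
    (hφ.differentiable (by simp) x).hasDerivAt
  have hc' : Continuous (deriv φ) := hφ.continuous_deriv (by simp)
  have hcf : Continuous fun x : ℝ => (fourier (-n) (x : Circ) : ℂ) :=
    (contDiff_fourier_circ (-n)).continuous
  have h := intervalIntegral.integral_mul_deriv_eq_deriv_mul (a := -π) (b := π)
    (u := fun x : ℝ => (fourier (-n) (x : Circ) : ℂ)) (v := φ)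
    (fun x _ => hasDerivAt_fourier_circ n x) (fun x _ => hd x)
    ((hcf.const_mul _).intervalIntegrable _ _) (hc'.intervalIntegrable _ _)
  have e1 : φ π = φ (-π) := by
    have := hp (-π)
    rw [show -π + 2 * π = π by ring] at this
    exact this
  have e2 : (fourier (-n) ((π : ℝ) : Circ) : ℂ) = fourier (-n) ((-π : ℝ) : Circ) := by
    have := periodic_coe_circ (fun x => (fourier (-n) x : ℂ)) (-π)
    simp only [show -π + 2 * π = π by ring] at this
    exact this
  rw [e1, e2, sub_self, zero_sub] at h
  have h1 := intervalIntegral_eq_integral_circMeasure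
    (fun x => fourier (-n) x * (hp'.lift : Circ → ℂ) x)
  have h2 := intervalIntegral_eq_integral_circMeasure
    (fun x => -(Complex.I * n) * fourier (-n) x * (hp.lift : Circ → ℂ) x)
  simp only [Function.Periodic.lift_coe] at h1 h2
  rw [h1, h2, ← smul_neg] at h
  have h3 := smul_right_injective ℂ Real.two_pi_pos.ne' h
  simp only [mul_assoc] at h3
  rw [integral_const_mul] at h3
  simp only [fourierCoeff, smul_eq_mul]
  rw [h3]
  simp only [neg_mul, neg_neg, mul_assoc]

/-- Integration by parts holds in `L²` because Parseval's identity transfers the factor `i n`. -/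
theorem hasWeakDeriv_of_fourierCoeff {f h : Circ → ℂ} (hf : MemLp f 2 circMeasure)
    (hh : MemLp h 2 circMeasure)
    (hfh : ∀ n : ℤ, fourierCoeff h n = Complex.I * n * fourierCoeff f n) : HasWeakDeriv f h := by
  refine ⟨hf.integrable_circ, hh.integrable_circ, fun φ hφ hp => ?_⟩
  have hp' : Function.Periodic (deriv φ) (2 * π) := fun x => by
    rw [← deriv_comp_add_const]
    exact congrArg (fun ψ => deriv ψ x) (funext hp)
  have hL : MemLp (hp.lift : Circ → ℂ) 2 circMeasure :=
    ContinuousMap.memLp circMeasure ℂ ⟨_, hp.continuous_lift_circ hφ.continuous⟩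
  have hL' : MemLp (hp'.lift : Circ → ℂ) 2 circMeasure :=
    ContinuousMap.memLp circMeasure ℂ
      ⟨_, hp'.continuous_lift_circ (hφ.continuous_deriv (by simp))⟩
  have h1 := hasSum_fourierCoeff_mul hf hL'
  have h2 := (hasSum_fourierCoeff_mul hh hL).neg
  have h3 : ∫ x, f x * (hp'.lift : Circ → ℂ) x ∂circMeasure =
      -∫ x, h x * (hp.lift : Circ → ℂ) x ∂circMeasure := by
    refine h1.unique ?_
    refine (congrArg (fun u => HasSum u _) (funext fun n => ?_)).mpr h2
    rw [fourierCoeff_lift_deriv hφ hp hp', hfh]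
    push_cast
    ring
  have e1 := intervalIntegral_eq_integral_circMeasure (fun x => f x * (hp'.lift : Circ → ℂ) x)
  have e2 := intervalIntegral_eq_integral_circMeasure (fun x => h x * (hp.lift : Circ → ℂ) x)
  simp only [Function.Periodic.lift_coe] at e1 e2
  rw [e1, e2, h3, smul_neg]

/-- A function with `∑ k² |f̂(k)|² < ∞` has a square integrable weak derivative. -/
theorem exists_hasWeakDeriv {f : Circ → ℂ} (hf : Integrable f circMeasure)
    (hf2 : Summable fun k : ℤ => (k : ℝ) ^ 2 * ‖fourierCoeff f k‖ ^ 2) :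
    ∃ f' : Circ → ℂ, HasWeakDeriv f f' ∧ MemLp f' 2 circMeasure := by
  obtain ⟨f₀, hf₀⟩ := exists_continuous_ae_eq hf (summable_fourierCoeff hf2)
  have hfL : MemLp f 2 circMeasure := (memLp_congr_ae hf₀).2 (f₀.memLp circMeasure ℂ)
  obtain ⟨h, hh, hhc⟩ := exists_memLp_fourierCoeff_eq
    (c := fun n => Complex.I * n * fourierCoeff f n) (by
      convert hf2 using 2 with n
      simp [mul_pow])
  exact ⟨h, hasWeakDeriv_of_fourierCoeff hfL hh hhc, hh⟩

/-- Weak derivatives are unique, so each of them is square integrable. -/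
theorem HasWeakDeriv.memLp {f f' : Circ → ℂ} (h : HasWeakDeriv f f')
    (hf2 : Summable fun k : ℤ => (k : ℝ) ^ 2 * ‖fourierCoeff f k‖ ^ 2) :
    MemLp f' 2 circMeasure := by
  obtain ⟨h', hh', hL⟩ := exists_hasWeakDeriv h.1 hf2
  refine (memLp_congr_ae (ae_eq_of_fourierCoeff_eq h.2.1 hh'.2.1 fun n => ?_)).2 hL
  rw [h.fourierCoeff_eq, hh'.fourierCoeff_eq]

/-- Parseval's identity for the weak derivatives. -/
theorem hasSum_sq_mul_fourierCoeff {f g f' g' : Circ → ℂ} (hf : HasWeakDeriv f f')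
    (hg : HasWeakDeriv g g')
    (hf2 : Summable fun k : ℤ => (k : ℝ) ^ 2 * ‖fourierCoeff f k‖ ^ 2)
    (hg2 : Summable fun k : ℤ => (k : ℝ) ^ 2 * ‖fourierCoeff g k‖ ^ 2) :
    HasSum (fun n : ℤ => (n : ℂ) ^ 2 * (fourierCoeff f n * fourierCoeff g (-n)))
      (∫ x, f' x * g' x ∂circMeasure) := by
  convert hasSum_fourierCoeff_mul (hf.memLp hf2) (hg.memLp hg2) using 2 with n
  rw [hf.fourierCoeff_eq, hg.fourierCoeff_eq]
  push_cast
  linear_combination ((n : ℂ) ^ 2 * fourierCoeff f n * fourierCoeff g (-n)) * Complex.I_sq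

/-! ### Moments of the Ginibre weight -/

instance ginibreWeight.sigmaFinite (N : ℕ) : SigmaFinite (ginibreWeight N) := by
  unfold ginibreWeight; exact SigmaFinite.withDensity_ofReal _

theorem integral_ginibreWeight (N : ℕ) (H : ℂ → ℂ) :
    ∫ z, H z ∂ginibreWeight N = ∫ z : ℂ, (Real.exp (-(N : ℝ) * ‖z‖ ^ 2) : ℂ) * H z := by
  rw [ginibreWeight, integral_withDensity_eq_integral_toReal_smul (by fun_prop) (by simp)]
  simp only [ENNReal.toReal_ofReal (Real.exp_pos _).le, Complex.real_smul]

theorem integral_radial {N : ℕ} (hN : 0 < N) (n : ℕ) :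
    ∫ r in Set.Ioi (0 : ℝ), r ^ (n + 1) * Real.exp (-(N : ℝ) * r ^ 2) =
      (N : ℝ) ^ (-((n : ℝ) / 2 + 1)) * (1 / 2) * Real.Gamma ((n : ℝ) / 2 + 1) := by
  have h := integral_rpow_mul_exp_neg_mul_rpow (p := 2) (q := ((n + 1 : ℕ) : ℝ)) (b := N)
    two_pos (by have : (0 : ℝ) ≤ ((n + 1 : ℕ) : ℝ) := Nat.cast_nonneg _
                linarith) (by exact_mod_cast hN)
  have e1 : (((n + 1 : ℕ) : ℝ) + 1) / 2 = (n : ℝ) / 2 + 1 := by push_cast; ring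
  have e2 : -(((n + 1 : ℕ) : ℝ) + 1) / 2 = -((n : ℝ) / 2 + 1) := by push_cast; ring
  rw [e1, e2] at h
  rw [← h]
  refine setIntegral_congr_fun measurableSet_Ioi fun r _ => ?_
  simp only [Real.rpow_natCast, Real.rpow_two]

/-- The moments of a function of the phase, computed in polar coordinates. -/
theorem integral_ofPhase_mul_moment {N : ℕ} (hN : 0 < N) (F : Circ → ℂ) (a b : ℕ) :
    ∫ z, ofPhase F z * (z ^ a * (starRingEnd ℂ) z ^ b) ∂ginibreWeight N =
      ((π * ((N : ℝ) ^ (-(((a + b : ℕ) : ℝ) / 2 + 1)) *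
        Real.Gamma (((a + b : ℕ) : ℝ) / 2 + 1)) : ℝ) : ℂ) * fourierCoeff F (b - a) := by
  rw [integral_ginibreWeight, ← Complex.integral_comp_polarCoord_symm]
  have hpolar : ∀ p ∈ polarCoord.target,
      p.1 • ((Real.exp (-(N : ℝ) * ‖Complex.polarCoord.symm p‖ ^ 2) : ℂ) *
        (ofPhase F (Complex.polarCoord.symm p) * (Complex.polarCoord.symm p ^ a *
          (starRingEnd ℂ) (Complex.polarCoord.symm p) ^ b))) =
      ((p.1 ^ (a + b + 1) * Real.exp (-(N : ℝ) * p.1 ^ 2) : ℝ) : ℂ) *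
        (fourier (-((b : ℤ) - a)) (p.2 : Circ) • F (p.2 : Circ)) := by
    rintro ⟨r, θ⟩ ⟨hr, hθ⟩
    have hr : 0 < r := hr
    have hθ : θ ∈ Set.Ioo (-π) π := hθ
    have hsymm : Complex.polarCoord.symm (r, θ) = r * Complex.exp (θ * Complex.I) := by
      rw [Complex.polarCoord_symm_apply, Complex.exp_mul_I, Complex.ofReal_cos, Complex.ofReal_sin]
    have harg : Complex.arg (r * Complex.exp (θ * Complex.I)) = θ := by
      rw [Complex.arg_real_mul _ hr, Complex.arg_exp_mul_I, toIocMod_eq_self]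
      exact ⟨hθ.1, by linarith [hθ.2]⟩
    have hconj : (starRingEnd ℂ) (r * Complex.exp (θ * Complex.I)) =
        r * Complex.exp (-(θ * Complex.I)) := by
      rw [map_mul, Complex.conj_ofReal, ← Complex.exp_conj]
      simp
    have hfour : (fourier (-((b : ℤ) - a)) (θ : Circ) : ℂ) =
        Complex.exp (θ * Complex.I) ^ a * Complex.exp (-(θ * Complex.I)) ^ b := by
      have : (π : ℂ) ≠ 0 := by exact_mod_cast Real.pi_ne_zero
      rw [fourier_coe_apply, ← Complex.exp_nat_mul, ← Complex.exp_nat_mul, ← Complex.exp_add]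
      congr 1
      push_cast
      field_simp
      ring
    have hnorm : ‖(r : ℂ) * Complex.exp (θ * Complex.I)‖ = r := by
      rw [norm_mul, Complex.norm_exp_ofReal_mul_I, mul_one, Complex.norm_real,
        Real.norm_of_nonneg hr.le]
    rw [hsymm, hnorm, hconj, hfour, ofPhase, harg, Complex.real_smul, smul_eq_mul]
    push_cast
    ring
  rw [setIntegral_congr_fun polarCoord.open_target.measurableSet hpolar, polarCoord_target,
    Measure.volume_eq_prod, setIntegral_prod_mul
      (fun r : ℝ => ((r ^ (a + b + 1) * Real.exp (-(N : ℝ) * r ^ 2) : ℝ) : ℂ))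
      (fun θ : ℝ => (fourier (-((b : ℤ) - a)) (θ : Circ) • F (θ : Circ) : ℂ)),
    integral_complex_ofReal, integral_radial hN, ← integral_Ioc_eq_integral_Ioo,
    ← intervalIntegral.integral_of_le (by linarith [Real.pi_pos]),
    intervalIntegral_eq_integral_circMeasure (fun x => fourier (-((b : ℤ) - a)) x • F x),
    fourierCoeff, Complex.real_smul]
  push_cast
  ring

theorem fourierCoeff_one (n : ℤ) :
    fourierCoeff (fun _ : Circ => (1 : ℂ)) n = if n = 0 then 1 else 0 := by
  have h := congrFun (fourierCoeff_fourier (T := 2 * π) 0) n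
  have h1 : (⇑(fourier 0 : C(Circ, ℂ))) = fun _ => (1 : ℂ) := funext fun x => fourier_zero
  rwa [h1, Pi.single_apply] at h

theorem integrable_moment {N : ℕ} (hN : 0 < N) (a b : ℕ) :
    Integrable (fun z : ℂ => z ^ a * (starRingEnd ℂ) z ^ b) (ginibreWeight N) := by
  -- A Bochner integral with a nonzero value is that of an integrable function.
  have hdiag : ∀ a : ℕ, Integrable (fun z : ℂ => z ^ a * (starRingEnd ℂ) z ^ a)
      (ginibreWeight N) := fun a => by
    refine Integrable.of_integral_ne_zero ?_
    have h := integral_ofPhase_mul_moment hN (fun _ => 1) a a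
    simp only [ofPhase, one_mul, sub_self, fourierCoeff_one, if_true, mul_one] at h
    rw [h]
    have hN' : (0 : ℝ) < N := by exact_mod_cast hN
    have hΓ : 0 < Real.Gamma (((a + a : ℕ) : ℝ) / 2 + 1) := Real.Gamma_pos_of_pos (by positivity)
    have : (0 : ℝ) < π * ((N : ℝ) ^ (-(((a + a : ℕ) : ℝ) / 2 + 1)) *
        Real.Gamma (((a + a : ℕ) : ℝ) / 2 + 1)) := by positivity
    exact_mod_cast this.ne'
  refine ((hdiag a).norm.add (hdiag b).norm).mono' ?_ (Eventually.of_forall fun z => ?_)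
  · exact Continuous.aestronglyMeasurable (by fun_prop)
  · simp only [norm_mul, norm_pow, RCLike.norm_conj, Pi.add_apply]
    nlinarith [sq_nonneg (‖z‖ ^ a - ‖z‖ ^ b), sq_nonneg (‖z‖ ^ a), sq_nonneg (‖z‖ ^ b)]

/-! ### Orthonormal monomials -/

/-- The normalization of the monomial `z ^ a` in `L²(exp (-N |z|²))`. -/
noncomputable def monomialConst (N a : ℕ) : ℝ := √((N : ℝ) ^ (a + 1)) / √(π * a.factorial)

theorem monomialConst_pos {N : ℕ} (hN : 0 < N) (a : ℕ) : 0 < monomialConst N a := by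
  have hN' : (0 : ℝ) < N := by exact_mod_cast hN
  have := Real.pi_pos
  unfold monomialConst
  positivity

theorem prod_monomialConst_sq_pos (N : ℕ) : 0 < (∏ a : Fin N, monomialConst N a) ^ 2 := by
  have h : ∀ a ∈ Finset.univ, 0 < monomialConst N (a : Fin N) := fun a _ =>
    monomialConst_pos a.pos a
  exact pow_pos (Finset.prod_pos h) 2

/-- The orthonormal monomials of the Ginibre weight. -/
noncomputable def ginibreMonomial (N : ℕ) (a : Fin N) (z : ℂ) : ℂ :=
  monomialConst N a * z ^ (a : ℕ)

/-- The complex conjugates of the orthonormal monomials. -/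
noncomputable def ginibreMonomialConj (N : ℕ) (a : Fin N) (z : ℂ) : ℂ :=
  monomialConst N a * (starRingEnd ℂ) z ^ (a : ℕ)

theorem ginibreMonomial_mul (N : ℕ) (a b : Fin N) (z : ℂ) :
    ginibreMonomial N a z * ginibreMonomialConj N b z =
      ((monomialConst N a * monomialConst N b : ℝ) : ℂ) *
        (z ^ (a : ℕ) * (starRingEnd ℂ) z ^ (b : ℕ)) := by
  rw [ginibreMonomial, ginibreMonomialConj]
  push_cast
  ring

theorem integrable_ginibreMonomial_mul (N : ℕ) (a b : Fin N) :
    Integrable (fun z => ginibreMonomial N a z * ginibreMonomialConj N b z)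
      (ginibreWeight N) := by
  simp_rw [ginibreMonomial_mul]
  exact (integrable_moment a.pos a b).const_mul _

theorem integrable_mul_ginibreMonomial_mul {N : ℕ} {H : ℂ → ℂ} (hH : Measurable H) {C : ℝ}
    (hC : ∀ z, ‖H z‖ ≤ C) (a b : Fin N) :
    Integrable (fun z => H z * (ginibreMonomial N a z * ginibreMonomialConj N b z))
      (ginibreWeight N) :=
  (integrable_ginibreMonomial_mul N a b).bdd_mul hH.aestronglyMeasurable
    (Eventually.of_forall hC)

theorem monomialConst_mul {N : ℕ} (hN : 0 < N) (a b : ℕ) :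
    monomialConst N a * monomialConst N b *
      (π * ((N : ℝ) ^ (-(((a + b : ℕ) : ℝ) / 2 + 1)) * Real.Gamma (((a + b : ℕ) : ℝ) / 2 + 1))) =
      Real.Gamma (((a + b : ℕ) : ℝ) / 2 + 1) / (√a.factorial * √b.factorial) := by
  have hN' : (0 : ℝ) < N := by exact_mod_cast hN
  have hpow : √((N : ℝ) ^ (a + 1)) * √((N : ℝ) ^ (b + 1)) *
      (N : ℝ) ^ (-(((a + b : ℕ) : ℝ) / 2 + 1)) = 1 := by
    rw [Real.sqrt_eq_rpow, Real.sqrt_eq_rpow, ← Real.rpow_natCast, ← Real.rpow_natCast,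
      ← Real.rpow_mul hN'.le, ← Real.rpow_mul hN'.le, ← Real.rpow_add hN', ← Real.rpow_add hN']
    convert Real.rpow_zero _ using 2
    push_cast
    ring
  have hπ : √π * √π = π := Real.mul_self_sqrt Real.pi_pos.le
  have hπ' : √π ≠ 0 := (Real.sqrt_pos.2 Real.pi_pos).ne'
  rw [monomialConst, monomialConst, Real.sqrt_mul Real.pi_pos.le, Real.sqrt_mul Real.pi_pos.le]
  have ha : √(a.factorial : ℝ) ≠ 0 := by positivity
  have hb : √(b.factorial : ℝ) ≠ 0 := by positivity
  calc _ = (√((N : ℝ) ^ (a + 1)) * √((N : ℝ) ^ (b + 1)) *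
        (N : ℝ) ^ (-(((a + b : ℕ) : ℝ) / 2 + 1))) * (π / (√π * √π)) *
        (Real.Gamma (((a + b : ℕ) : ℝ) / 2 + 1) / (√a.factorial * √b.factorial)) := by
          field_simp
    _ = _ := by rw [hpow, hπ, div_self Real.pi_ne_zero, one_mul, one_mul]

/-- The matrix entries of a function of the phase in the orthonormal monomials. -/
theorem mulEntry_ofPhase {N : ℕ} (F : Circ → ℂ) (a b : Fin N) :
    mulEntry (ginibreWeight N) (ginibreMonomial N) (ginibreMonomialConj N) (ofPhase F) a b =
      ((Real.Gamma (((a + b : ℕ) : ℝ) / 2 + 1) /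
        (√(a : ℕ).factorial * √(b : ℕ).factorial) : ℝ) : ℂ) *
        fourierCoeff F ((b : ℕ) - (a : ℕ)) := by
  have h : ∀ z, ofPhase F z * (ginibreMonomial N a z * ginibreMonomialConj N b z) =
      ((monomialConst N a * monomialConst N b : ℝ) : ℂ) *
        (ofPhase F z * (z ^ (a : ℕ) * (starRingEnd ℂ) z ^ (b : ℕ))) := fun z => by
    rw [ginibreMonomial_mul]; ring
  rw [mulEntry]
  simp_rw [h]
  rw [integral_const_mul, integral_ofPhase_mul_moment a.pos, ← mul_assoc, ← Complex.ofReal_mul,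
    monomialConst_mul a.pos]

theorem integral_ginibreMonomial_mul (N : ℕ) (a b : Fin N) :
    ∫ z, ginibreMonomial N a z * ginibreMonomialConj N b z ∂ginibreWeight N =
      if a = b then 1 else 0 := by
  have h := mulEntry_ofPhase (N := N) (fun _ => 1) a b
  simp only [mulEntry, ofPhase, one_mul, fourierCoeff_one] at h
  rw [h]
  by_cases hab : a = b
  · subst hab
    have e : (((a + a : ℕ) : ℝ) / 2 + 1) = ((a : ℕ) : ℝ) + 1 := by push_cast; ring
    rw [e, Real.Gamma_nat_eq_factorial, Real.mul_self_sqrt (Nat.cast_nonneg _),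
      div_self (by positivity)]
    simp
  · have : ((b : ℕ) : ℤ) - ((a : ℕ) : ℤ) ≠ 0 := by
      intro h0
      exact hab (Fin.ext (by omega))
    simp [this, hab]

/-! ### The Ginibre law as a biorthogonal ensemble -/

/-- The squared Vandermonde determinant. -/
noncomputable def vandermondeSq {N : ℕ} (z : Fin N → ℂ) : ℝ :=
  ∏ l : Fin N, ∏ k ∈ Finset.Ioi l, ‖z l - z k‖ ^ 2

theorem vandermondeSq_nonneg {N : ℕ} (z : Fin N → ℂ) : 0 ≤ vandermondeSq z :=
  Finset.prod_nonneg fun _ _ => Finset.prod_nonneg fun _ _ => by positivity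

theorem measurable_vandermondeSq {N : ℕ} : Measurable (vandermondeSq : (Fin N → ℂ) → ℝ) := by
  unfold vandermondeSq
  fun_prop

theorem biorthDensity_ginibre {N : ℕ} (z : Fin N → ℂ) :
    biorthDensity (ginibreMonomial N) (ginibreMonomialConj N) z =
      (((∏ a : Fin N, monomialConst N a) ^ 2 * vandermondeSq z : ℝ) : ℂ) := by
  have hdet : ∀ w : Fin N → ℂ, (Matrix.of fun a k : Fin N =>
      (monomialConst N a : ℂ) * w k ^ (a : ℕ)).det =
      (∏ a : Fin N, (monomialConst N a : ℂ)) * ∏ i, ∏ j ∈ Finset.Ioi i, (w j - w i) := by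
    intro w
    rw [← Matrix.det_vandermonde, ← Matrix.det_transpose (Matrix.vandermonde w),
      ← Matrix.det_mul_column]
    rfl
  have h1 := hdet z
  have h2 := hdet fun k => (starRingEnd ℂ) (z k)
  rw [biorthDensity]
  simp only [ginibreMonomial, ginibreMonomialConj]
  rw [h1, h2]
  have h3 : (∏ i : Fin N, ∏ j ∈ Finset.Ioi i, (z j - z i)) *
      (∏ i : Fin N, ∏ j ∈ Finset.Ioi i, ((starRingEnd ℂ) (z j) - (starRingEnd ℂ) (z i))) =
      ((vandermondeSq z : ℝ) : ℂ) := by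
    rw [vandermondeSq, ← Finset.prod_mul_distrib, Complex.ofReal_prod]
    refine Finset.prod_congr rfl fun i _ => ?_
    rw [← Finset.prod_mul_distrib, Complex.ofReal_prod]
    refine Finset.prod_congr rfl fun j _ => ?_
    rw [← map_sub, Complex.mul_conj, Complex.normSq_eq_norm_sq, norm_sub_rev]
  push_cast
  rw [← h3]
  ring

theorem integrable_vandermondeSq (N : ℕ) :
    Integrable (vandermondeSq : (Fin N → ℂ) → ℝ) (Measure.pi fun _ => ginibreWeight N) := by
  have h := integrable_biorthDensity (integrable_ginibreMonomial_mul N)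
  have hC := prod_monomialConst_sq_pos N
  have h2 := (h.re).const_mul ((∏ a : Fin N, monomialConst N a) ^ 2)⁻¹
  refine h2.congr (Eventually.of_forall fun z => ?_)
  simp only [biorthDensity_ginibre]
  rw [show RCLike.re (((∏ a : Fin N, monomialConst N a) ^ 2 * vandermondeSq z : ℝ) : ℂ) =
    (∏ a : Fin N, monomialConst N a) ^ 2 * vandermondeSq z from Complex.ofReal_re _,
    inv_mul_cancel_left₀ hC.ne']

theorem integral_vandermondeSq (N : ℕ) :
    (∏ a : Fin N, monomialConst N a) ^ 2 *
      ∫ z, vandermondeSq z ∂(Measure.pi fun _ : Fin N => ginibreWeight N) = N.factorial := by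
  have h := integral_biorthDensity (integrable_ginibreMonomial_mul N)
    (integral_ginibreMonomial_mul N)
  simp_rw [biorthDensity_ginibre] at h
  rw [integral_complex_ofReal, integral_const_mul, Fintype.card_fin] at h
  exact_mod_cast h

theorem ginibreUnnormalized_eq (N : ℕ) : ginibreUnnormalized N =
    (Measure.pi fun _ : Fin N => ginibreWeight N).withDensity fun z =>
      ENNReal.ofReal (vandermondeSq z) := rfl

theorem ginibreUnnormalized_univ (N : ℕ) :
    ginibreUnnormalized N Set.univ = ENNReal.ofReal
      (∫ z, vandermondeSq z ∂(Measure.pi fun _ : Fin N => ginibreWeight N)) := by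
  rw [ginibreUnnormalized, withDensity_apply _ MeasurableSet.univ, Measure.restrict_univ,
    ofReal_integral_eq_lintegral_ofReal (integrable_vandermondeSq N)
      (Eventually.of_forall vandermondeSq_nonneg)]
  rfl

theorem integral_vandermondeSq_pos (N : ℕ) :
    0 < ∫ z, vandermondeSq z ∂(Measure.pi fun _ : Fin N => ginibreWeight N) := by
  have hC := prod_monomialConst_sq_pos N
  have h := integral_vandermondeSq N
  have hf : (0 : ℝ) < N.factorial := by positivity
  rw [← h] at hf
  exact (mul_pos_iff_of_pos_left hC).1 hf

instance ginibreLaw.isProbabilityMeasure (N : ℕ) : IsProbabilityMeasure (ginibreLaw N) := by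
  constructor
  rw [ginibreLaw, Measure.smul_apply, smul_eq_mul, ginibreUnnormalized_univ]
  exact ENNReal.inv_mul_cancel (by simpa using integral_vandermondeSq_pos N) ENNReal.ofReal_ne_top

theorem integral_ginibreLaw {N : ℕ} (H : (Fin N → ℂ) → ℂ) :
    ∫ z, H z ∂ginibreLaw N = (N.factorial : ℂ)⁻¹ *
      ∫ z, H z * biorthDensity (ginibreMonomial N) (ginibreMonomialConj N) z
        ∂(Measure.pi fun _ => ginibreWeight N) := by
  have hC := prod_monomialConst_sq_pos N
  have hI := integral_vandermondeSq_pos N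
  rw [ginibreLaw, integral_smul_measure, ginibreUnnormalized_univ, ENNReal.toReal_inv,
    ENNReal.toReal_ofReal hI.le, ginibreUnnormalized_eq,
    integral_withDensity_eq_integral_toReal_smul
      (measurable_vandermondeSq.ennreal_ofReal) (by simp)]
  have h1 : ∀ z : Fin N → ℂ, H z * biorthDensity (ginibreMonomial N) (ginibreMonomialConj N) z =
      (((∏ a : Fin N, monomialConst N a) ^ 2 : ℝ) : ℂ) * ((vandermondeSq z : ℂ) * H z) := by
    intro z
    rw [biorthDensity_ginibre]
    push_cast
    ring
  have h2 : ∀ z : Fin N → ℂ, (ENNReal.ofReal (vandermondeSq z)).toReal • H z =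
      (vandermondeSq z : ℂ) * H z := by
    intro z
    rw [ENNReal.toReal_ofReal (vandermondeSq_nonneg z), Complex.real_smul]
  simp_rw [h1, h2]
  rw [integral_const_mul, Complex.real_smul, ← mul_assoc]
  congr 1
  have h3 := integral_vandermondeSq N
  have : (∫ z, vandermondeSq z ∂(Measure.pi fun _ : Fin N => ginibreWeight N))⁻¹ =
      (N.factorial : ℝ)⁻¹ * (∏ a : Fin N, monomialConst N a) ^ 2 := by
    rw [← h3, mul_inv, mul_right_comm, inv_mul_cancel₀ hC.ne', one_mul]
  rw [this]
  push_cast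
  ring

/-! ### The covariance of phase statistics -/

theorem measurable_ofPhase (F : C(Circ, ℂ)) : Measurable (ofPhase F) :=
  F.continuous.measurable.comp
    ((AddCircle.continuous_mk' (2 * π)).measurable.comp Complex.measurable_arg)

/-- The exact covariance of two phase statistics at finite `N`: the monomials diagonalize the
angular variable, so the matrix entries of `F` are Fourier coefficients times radial moments. -/
theorem ginibreCov_ofPhase (N : ℕ) (F G : C(Circ, ℂ)) :
    ginibreCov N (ofPhase F) (ofPhase G) =
      N * ∫ x, F x * G x ∂circMeasure -
        ∑ a : Fin N, ∑ b : Fin N,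
          ((Real.Gamma (((a + b : ℕ) : ℝ) / 2 + 1) ^ 2 /
            ((a : ℕ).factorial * (b : ℕ).factorial) : ℝ) : ℂ) *
          (fourierCoeff F ((b : ℕ) - (a : ℕ)) * fourierCoeff G ((a : ℕ) - (b : ℕ))) := by
  have hb : ∀ (K : C(Circ, ℂ)) a b, Integrable (fun z => ofPhase K z *
      (ginibreMonomial N a z * ginibreMonomialConj N b z)) (ginibreWeight N) := fun K =>
    integrable_mul_ginibreMonomial_mul (measurable_ofPhase K) fun z => K.norm_coe_le_norm _
  have hφψ := integrable_ginibreMonomial_mul N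
  have horth := integral_ginibreMonomial_mul N
  have hmul : (fun z => ofPhase F z * ofPhase G z) = ofPhase (fun x => F x * G x) := rfl
  have h1 := fun K : C(Circ, ℂ) => integral_sum_mul_biorthDensity hφψ horth (hb K)
  have h2 := integral_sum_mul_sum_mul_biorthDensity hφψ horth (hb F) (hb G) (hb (F * G))
  have hne : (N.factorial : ℂ) ≠ 0 := by exact_mod_cast N.factorial_ne_zero
  rw [ginibreCov]
  simp only [integral_ginibreLaw, linearStatistic]
  rw [h1 F, h1 G, h2, Fintype.card_fin, inv_mul_cancel_left₀ hne, inv_mul_cancel_left₀ hne,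
    inv_mul_cancel_left₀ hne, hmul]
  have hdiag : ∀ a : Fin N, mulEntry (ginibreWeight N) (ginibreMonomial N)
      (ginibreMonomialConj N) (ofPhase fun x => F x * G x) a a =
      ∫ x, F x * G x ∂circMeasure := by
    intro a
    have h0 := integral_ginibreMonomial_mul N a a
    have h3 := mulEntry_ofPhase (N := N) (fun _ => 1) a a
    simp only [mulEntry, ofPhase, one_mul, fourierCoeff_one, sub_self, if_true, mul_one] at h3
    rw [h0, if_pos rfl] at h3
    rw [mulEntry_ofPhase, ← h3, sub_self, one_mul, fourierCoeff]
    simp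
  have hoff : ∀ a b : Fin N,
      mulEntry (ginibreWeight N) (ginibreMonomial N) (ginibreMonomialConj N) (ofPhase F) a b *
      mulEntry (ginibreWeight N) (ginibreMonomial N) (ginibreMonomialConj N) (ofPhase G) b a =
      ((Real.Gamma (((a + b : ℕ) : ℝ) / 2 + 1) ^ 2 /
        ((a : ℕ).factorial * (b : ℕ).factorial) : ℝ) : ℂ) *
      (fourierCoeff F ((b : ℕ) - (a : ℕ)) * fourierCoeff G ((a : ℕ) - (b : ℕ))) := by
    intro a b
    rw [mulEntry_ofPhase, mulEntry_ofPhase, add_comm (b : ℕ) (a : ℕ)]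
    have hs : Real.Gamma (((a + b : ℕ) : ℝ) / 2 + 1) ^ 2 /
        ((a : ℕ).factorial * (b : ℕ).factorial) =
        (Real.Gamma (((a + b : ℕ) : ℝ) / 2 + 1) / (√(a : ℕ).factorial * √(b : ℕ).factorial)) *
        (Real.Gamma (((a + b : ℕ) : ℝ) / 2 + 1) / (√(b : ℕ).factorial * √(a : ℕ).factorial)) := by
      have ha := Real.sq_sqrt (Nat.cast_nonneg (a : ℕ).factorial : (0 : ℝ) ≤ _)
      have hb := Real.sq_sqrt (Nat.cast_nonneg (b : ℕ).factorial : (0 : ℝ) ≤ _)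
      rw [div_mul_div_comm, ← ha, ← hb, Real.sqrt_sq (Real.sqrt_nonneg _),
        Real.sqrt_sq (Real.sqrt_nonneg _)]
      ring
    rw [hs]
    push_cast
    ring
  simp only [hdiag, hoff, Finset.sum_const, Finset.card_univ, Fintype.card_fin, nsmul_eq_mul]
  ring

/-! ### Almost everywhere equal functions of the phase -/

/-- The phase of Lebesgue almost every point avoids a null set of the circle. -/
theorem ae_arg_of_ae {p : Circ → Prop} (hp : ∀ᵐ x ∂circMeasure, p x) :
    ∀ᵐ z : ℂ, p ((Complex.arg z : ℝ) : Circ) := by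
  obtain ⟨t, hts, htm, ht0⟩ := exists_measurable_superset_of_null (ae_iff.1 hp)
  have hmeas : Measurable fun z : ℂ => ((Complex.arg z : ℝ) : Circ) :=
    (AddCircle.continuous_mk' (2 * π)).measurable.comp Complex.measurable_arg
  have htv : (volume : Measure Circ) t = 0 := by
    rw [AddCircle.volume_eq_smul_haarAddCircle, Measure.smul_apply, ht0, smul_zero]
  have hIoo : ∀ᵐ θ ∂(volume.restrict (Set.Ioo (-π) π)), ((θ : ℝ) : Circ) ∉ t := by
    have h := (AddCircle.measurePreserving_mk (2 * π) (-π)).quasiMeasurePreserving.ae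
      (p := fun x => x ∉ t) (by rw [ae_iff]; simpa using htv)
    refine ae_mono (Measure.restrict_mono ?_ le_rfl) h
    intro θ hθ
    exact ⟨hθ.1, by linarith [hθ.2]⟩
  have hprod : ∀ᵐ q ∂((volume : Measure (ℝ × ℝ)).restrict polarCoord.target),
      ((q.2 : ℝ) : Circ) ∉ t := by
    rw [polarCoord_target, Measure.volume_eq_prod, ← Measure.prod_restrict]
    exact Measure.quasiMeasurePreserving_snd.ae hIoo
  have h0 : volume ((fun z : ℂ => ((Complex.arg z : ℝ) : Circ)) ⁻¹' t) = 0 := by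
    rw [← lintegral_indicator_one (hmeas htm), ← Complex.lintegral_comp_polarCoord_symm]
    refine (lintegral_congr_ae ?_).trans lintegral_zero
    filter_upwards [hprod, ae_restrict_mem polarCoord.open_target.measurableSet] with q hq hqt
    have harg : Complex.arg (Complex.polarCoord.symm q) = q.2 := by
      have h := Complex.polarCoord.right_inv (x := q) hqt
      rw [Complex.polarCoord_apply] at h
      exact congrArg Prod.snd h
    rw [Set.indicator_of_notMem, smul_zero]
    rwa [Set.mem_preimage, harg]
  rw [ae_iff]
  exact measure_mono_null (fun z hz => hts hz) h0

theorem ginibreLaw_absolutelyContinuous (N : ℕ) :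
    ginibreLaw N ≪ Measure.pi fun _ : Fin N => ginibreWeight N :=
  (Measure.smul_absolutelyContinuous).trans (withDensity_absolutelyContinuous _ _)

theorem linearStatistic_ae_eq {f f₀ : Circ → ℂ} (hf : f =ᵐ[circMeasure] f₀) (N : ℕ) :
    (linearStatistic (ofPhase f) : (Fin N → ℂ) → ℂ) =ᵐ[ginibreLaw N]
      linearStatistic (ofPhase f₀) := by
  have h1 : ∀ᵐ z ∂ginibreWeight N, ofPhase f z = ofPhase f₀ z :=
    (withDensity_absolutelyContinuous _ _).ae_le (ae_arg_of_ae hf)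
  have h2 : ∀ᵐ z ∂(Measure.pi fun _ : Fin N => ginibreWeight N),
      ∀ k, ofPhase f (z k) = ofPhase f₀ (z k) :=
    ae_all_iff.2 fun k =>
      (Measure.quasiMeasurePreserving_eval (fun _ : Fin N => ginibreWeight N) k).ae h1
  filter_upwards [(ginibreLaw_absolutelyContinuous N).ae_le h2] with z hz
  simp only [linearStatistic, hz]

theorem ginibreCov_congr {f f₀ g g₀ : Circ → ℂ} (hf : f =ᵐ[circMeasure] f₀)
    (hg : g =ᵐ[circMeasure] g₀) (N : ℕ) :
    ginibreCov N (ofPhase f) (ofPhase g) = ginibreCov N (ofPhase f₀) (ofPhase g₀) := by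
  have h1 := linearStatistic_ae_eq hf N
  have h2 := linearStatistic_ae_eq hg N
  rw [ginibreCov, ginibreCov, integral_congr_ae h1, integral_congr_ae h2,
    show ∫ z, linearStatistic (ofPhase f) z * linearStatistic (ofPhase g) z ∂ginibreLaw N =
      ∫ z, linearStatistic (ofPhase f₀) z * linearStatistic (ofPhase g₀) z ∂ginibreLaw N from
      integral_congr_ae (h1.mul h2)]

theorem memLp_linearStatistic {f : Circ → ℂ} {f₀ : C(Circ, ℂ)} (hf : f =ᵐ[circMeasure] f₀)
    (N : ℕ) : MemLp (linearStatistic (ofPhase f)) 2 (ginibreLaw N) := by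
  refine (memLp_congr_ae (linearStatistic_ae_eq hf N)).2 (MemLp.of_bound ?_ (N * ‖f₀‖) ?_)
  · have := measurable_ofPhase f₀
    unfold linearStatistic
    exact Measurable.aestronglyMeasurable (by fun_prop)
  · refine Eventually.of_forall fun z => (norm_sum_le _ _).trans ?_
    refine (Finset.sum_le_sum fun k _ => f₀.norm_coe_le_norm _).trans ?_
    simp

/-! ### The covariance as a sum over frequencies -/

/-- Summation of the squared normalized moments along a diagonal above the main one. -/
theorem sum_moment_diagonal (N n : ℕ) :
    ∑ a ∈ Finset.range N, ∑ b ∈ Finset.range N, (if b = a + n then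
      Real.Gamma (((a + b : ℕ) : ℝ) / 2 + 1) ^ 2 / (a.factorial * b.factorial) else 0) =
      ∑ j ∈ Finset.range (N - n), gammaRatio n j := by
  have hdiag : ∀ a, Real.Gamma (((a + (a + n) : ℕ) : ℝ) / 2 + 1) ^ 2 /
      (a.factorial * (a + n).factorial) = gammaRatio n a := fun a => by
    rw [gammaRatio]
    congr 3
    push_cast
    ring
  simp only [Finset.sum_ite_eq', hdiag, ← Finset.sum_filter]
  refine Finset.sum_congr ?_ fun _ _ => rfl
  ext a
  simp only [Finset.mem_filter, Finset.mem_range]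
  omega

theorem sum_moment_frequency (N : ℕ) (m : ℤ) :
    ∑ a : Fin N, ∑ b : Fin N, (if m = ((b : ℕ) : ℤ) - (a : ℕ) then
      Real.Gamma (((a + b : ℕ) : ℝ) / 2 + 1) ^ 2 / ((a : ℕ).factorial * (b : ℕ).factorial) else 0) =
      ∑ j ∈ Finset.range (N - m.natAbs), gammaRatio m.natAbs j := by
  have hfin : ∀ t : ℕ → ℕ → ℝ, ∑ a : Fin N, ∑ b : Fin N, t a b =
      ∑ a ∈ Finset.range N, ∑ b ∈ Finset.range N, t a b := fun t => by
    simp only [Finset.sum_range]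
  rw [hfin fun a b => if m = (b : ℤ) - a then
    Real.Gamma (((a + b : ℕ) : ℝ) / 2 + 1) ^ 2 / (a.factorial * b.factorial) else 0,
    ← sum_moment_diagonal]
  rcases le_total 0 m with hm | hm
  · refine Finset.sum_congr rfl fun a _ => Finset.sum_congr rfl fun b _ => ?_
    exact if_congr (by omega) rfl rfl
  · rw [Finset.sum_comm]
    refine Finset.sum_congr rfl fun a _ => Finset.sum_congr rfl fun b _ => ?_
    refine if_congr (by omega) ?_ rfl
    rw [add_comm b a, mul_comm]

theorem hasSum_ginibreCov (N : ℕ) (F G : C(Circ, ℂ)) :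
    HasSum (fun m : ℤ => (covCoeff N m.natAbs : ℂ) * (fourierCoeff F m * fourierCoeff G (-m)))
      (ginibreCov N (ofPhase F) (ofPhase G)) := by
  have h1 := (hasSum_fourierCoeff_mul (F.memLp circMeasure ℂ) (G.memLp circMeasure ℂ)).mul_left
    (N : ℂ)
  have h2 : HasSum (fun m : ℤ => ∑ a : Fin N, ∑ b : Fin N,
      if m = ((b : ℕ) : ℤ) - (a : ℕ) then
        ((Real.Gamma (((a + b : ℕ) : ℝ) / 2 + 1) ^ 2 /
          ((a : ℕ).factorial * (b : ℕ).factorial) : ℝ) : ℂ) *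
          (fourierCoeff F ((b : ℕ) - (a : ℕ)) * fourierCoeff G ((a : ℕ) - (b : ℕ))) else 0)
      (∑ a : Fin N, ∑ b : Fin N, ((Real.Gamma (((a + b : ℕ) : ℝ) / 2 + 1) ^ 2 /
          ((a : ℕ).factorial * (b : ℕ).factorial) : ℝ) : ℂ) *
          (fourierCoeff F ((b : ℕ) - (a : ℕ)) * fourierCoeff G ((a : ℕ) - (b : ℕ)))) :=
    hasSum_sum fun a _ => hasSum_sum fun b _ => hasSum_ite_eq _ _
  rw [ginibreCov_ofPhase]
  refine (congrArg (fun u => HasSum u _) (funext fun m => ?_)).mpr (h1.sub h2)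
  rw [covCoeff, ← sum_moment_frequency]
  push_cast
  rw [sub_mul, Finset.sum_mul]
  congr 1
  refine Finset.sum_congr rfl fun a _ => ?_
  rw [Finset.sum_mul]
  refine Finset.sum_congr rfl fun b _ => ?_
  split_ifs with h
  · rw [h, neg_sub]
    push_cast
    rfl
  · simp

/-! ### Asymptotics -/

/-- The error of the leading asymptotics of the coefficient of the frequency `m`. -/
noncomputable def covError (N : ℕ) (m : ℤ) : ℝ :=
  covCoeff N m.natAbs - (m : ℝ) ^ 2 / 4 * Real.log N

theorem natAbs_sq_real (m : ℤ) : ((m.natAbs : ℕ) : ℝ) ^ 2 = (m : ℝ) ^ 2 := by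
  rw [Nat.cast_natAbs, Int.cast_abs, sq_abs]

theorem abs_covError_le {N : ℕ} (hN : 1 ≤ N) (m : ℤ) :
    |covError N m| ≤ (m : ℝ) ^ 2 * (5 / 4 + Real.log (1 + m.natAbs / 2)) := by
  have h := abs_covCoeff_sub_le N m.natAbs hN
  rwa [natAbs_sq_real] at h

theorem abs_covError_le_log {N : ℕ} (hN : 3 ≤ N) (m : ℤ) :
    |covError N m| ≤ 5 / 4 * (m : ℝ) ^ 2 * Real.log N := by
  have h := abs_covCoeff_sub_le_log N m.natAbs hN
  rwa [natAbs_sq_real] at h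

theorem tendsto_covError_div_log (m : ℤ) :
    Tendsto (fun N : ℕ => covError N m / Real.log N) atTop (nhds 0) := by
  have hlog : Tendsto (fun N : ℕ => Real.log N) atTop atTop :=
    Real.tendsto_log_atTop.comp tendsto_natCast_atTop_atTop
  refine squeeze_zero_norm' ?_ (tendsto_const_nhds.div_atTop hlog
    (a := (m : ℝ) ^ 2 * (5 / 4 + Real.log (1 + m.natAbs / 2))))
  filter_upwards [eventually_ge_atTop 1] with N hN
  have h0 : 0 ≤ Real.log N := Real.log_natCast_nonneg N
  rw [norm_div, Real.norm_eq_abs, Real.norm_of_nonneg h0]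
  exact div_le_div_of_nonneg_right (abs_covError_le hN m) h0

theorem hasSum_covError {f g f' g' : Circ → ℂ} (hf : HasWeakDeriv f f') (hg : HasWeakDeriv g g')
    (hf2 : Summable fun k : ℤ => (k : ℝ) ^ 2 * ‖fourierCoeff f k‖ ^ 2)
    (hg2 : Summable fun k : ℤ => (k : ℝ) ^ 2 * ‖fourierCoeff g k‖ ^ 2) (N : ℕ) :
    HasSum (fun m : ℤ => (covError N m : ℂ) * (fourierCoeff f m * fourierCoeff g (-m)))
      (ginibreCov N (ofPhase f) (ofPhase g) -
        ((Real.log N / 4 : ℝ) : ℂ) * ∫ θ, f' θ * g' θ ∂circMeasure) := by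
  obtain ⟨F, hF⟩ := exists_continuous_ae_eq hf.1 (summable_fourierCoeff hf2)
  obtain ⟨G, hG⟩ := exists_continuous_ae_eq hg.1 (summable_fourierCoeff hg2)
  have h1 := hasSum_ginibreCov N F G
  rw [← ginibreCov_congr hF hG, ← fourierCoeff_congr_ae hF, ← fourierCoeff_congr_ae hG] at h1
  have h2 := (hasSum_sq_mul_fourierCoeff hf hg hf2 hg2).mul_left ((Real.log N / 4 : ℝ) : ℂ)
  refine (congrArg (fun u => HasSum u _) (funext fun m => ?_)).mpr (h1.sub h2)
  rw [covError]
  push_cast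
  ring

/-- Summability in the Cauchy–Schwarz inequality for two weighted `ℓ²` sequences. -/
theorem summable_weight_mul {u v : ℤ → ℝ} {x y : ℤ → ℂ}
    (hx : Summable fun k => u k ^ 2 * ‖x k‖ ^ 2) (hy : Summable fun k => v k ^ 2 * ‖y k‖ ^ 2) :
    Summable fun k => |u k| * |v k| * ‖x k * y k‖ := by
  refine Summable.of_nonneg_of_le (fun k => by positivity) (fun k => ?_) (hx.add hy)
  have h1 : u k ^ 2 * ‖x k‖ ^ 2 = (|u k| * ‖x k‖) ^ 2 := by rw [mul_pow, sq_abs]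
  have h2 : v k ^ 2 * ‖y k‖ ^ 2 = (|v k| * ‖y k‖) ^ 2 := by rw [mul_pow, sq_abs]
  rw [h1, h2, norm_mul]
  nlinarith [sq_nonneg (|u k| * ‖x k‖ - |v k| * ‖y k‖), sq_nonneg (|u k| * ‖x k‖),
    sq_nonneg (|v k| * ‖y k‖)]

theorem summable_neg_fourierCoeff {w : ℤ → ℝ} (hw : ∀ k, w (-k) = w k) {g : Circ → ℂ}
    (hg : Summable fun k : ℤ => w k * ‖fourierCoeff g k‖ ^ 2) :
    Summable fun k : ℤ => w k * ‖fourierCoeff g (-k)‖ ^ 2 := by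
  have h := (Equiv.neg ℤ).summable_iff.2 hg
  simpa [Function.comp_def, hw] using h

/-- The logarithm in the uniform error is absorbed by a small power. -/
theorem abs_covError_le_rpow {δ : ℝ} (hδ : 0 < δ) {N : ℕ} (hN : 1 ≤ N) (m : ℤ) :
    |covError N m| ≤ (5 / 4 + 2 ^ (δ / 2) / (δ / 2)) * (|(m : ℝ)| * |(m : ℝ)| ^ (1 + δ / 2)) := by
  refine (abs_covError_le hN m).trans ?_
  rcases eq_or_ne m 0 with rfl | hm
  · simp
  have hm1 : (1 : ℝ) ≤ |(m : ℝ)| := by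
    exact_mod_cast Int.one_le_abs hm
  have hnat : ((m.natAbs : ℕ) : ℝ) = |(m : ℝ)| := by
    rw [Nat.cast_natAbs, Int.cast_abs]
  have hpow : 1 ≤ |(m : ℝ)| ^ (δ / 2) := Real.one_le_rpow hm1 (by positivity)
  have hlog : Real.log (1 + m.natAbs / 2) ≤ 2 ^ (δ / 2) / (δ / 2) * |(m : ℝ)| ^ (δ / 2) := by
    rw [hnat]
    calc Real.log (1 + |(m : ℝ)| / 2) ≤ Real.log (2 * |(m : ℝ)|) :=
          Real.log_le_log (by positivity) (by linarith)
      _ ≤ (2 * |(m : ℝ)|) ^ (δ / 2) / (δ / 2) :=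
          Real.log_le_rpow_div (by positivity) (by positivity)
      _ = _ := by rw [Real.mul_rpow two_pos.le (abs_nonneg _)]; ring
  have hsplit : |(m : ℝ)| * |(m : ℝ)| ^ (1 + δ / 2) = (m : ℝ) ^ 2 * |(m : ℝ)| ^ (δ / 2) := by
    rw [Real.rpow_add (by positivity), Real.rpow_one, ← mul_assoc, abs_mul_abs_self, sq]
  rw [hsplit, mul_left_comm]
  refine mul_le_mul_of_nonneg_left ?_ (sq_nonneg _)
  rw [add_mul]
  exact add_le_add (le_mul_of_one_le_right (by norm_num) hpow) hlog

theorem sq_abs_rpow (m : ℤ) (δ : ℝ) :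
    (|(m : ℝ)| ^ (1 + δ / 2)) ^ 2 = |(m : ℝ)| ^ (2 + δ) := by
  rw [← Real.rpow_natCast, ← Real.rpow_mul (abs_nonneg _)]
  congr 1
  push_cast
  ring

/-- The frequency weights of the error term are summable under the stronger hypothesis on one of
the two functions. -/
theorem summable_rpow_mul_fourierCoeff {f g : Circ → ℂ} {δ : ℝ}
    (hf2 : Summable fun k : ℤ => (k : ℝ) ^ 2 * ‖fourierCoeff f k‖ ^ 2)
    (hg2 : Summable fun k : ℤ => (k : ℝ) ^ 2 * ‖fourierCoeff g k‖ ^ 2)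
    (h : (Summable fun k : ℤ => |(k : ℝ)| ^ (2 + δ) * ‖fourierCoeff f k‖ ^ 2) ∨
      Summable fun k : ℤ => |(k : ℝ)| ^ (2 + δ) * ‖fourierCoeff g k‖ ^ 2) :
    Summable fun k : ℤ => |(k : ℝ)| * |(k : ℝ)| ^ (1 + δ / 2) *
      ‖fourierCoeff f k * fourierCoeff g (-k)‖ := by
  have habs : ∀ k : ℤ, |(|(k : ℝ)| ^ (1 + δ / 2))| = |(k : ℝ)| ^ (1 + δ / 2) := fun k =>
    abs_of_nonneg (by positivity)
  rcases h with h | h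
  · have h1 := summable_weight_mul (u := fun k : ℤ => |(k : ℝ)| ^ (1 + δ / 2))
      (v := fun k : ℤ => (k : ℝ)) (x := fourierCoeff f) (y := fun k => fourierCoeff g (-k))
      (by simpa only [sq_abs_rpow] using h)
      (summable_neg_fourierCoeff (w := fun k : ℤ => (k : ℝ) ^ 2) (by simp) hg2)
    refine h1.congr fun k => ?_
    rw [habs, mul_comm |(k : ℝ)|]
  · have h1 := summable_weight_mul (u := fun k : ℤ => (k : ℝ))
      (v := fun k : ℤ => |(k : ℝ)| ^ (1 + δ / 2)) (x := fourierCoeff f)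
      (y := fun k => fourierCoeff g (-k)) hf2 (by
        simp only [sq_abs_rpow]
        exact summable_neg_fourierCoeff (w := fun k : ℤ => |(k : ℝ)| ^ (2 + δ)) (by simp) h)
    simpa only [habs] using h1

theorem ginibreCov_isLittleO {f g f' g' : Circ → ℂ} (hf : HasWeakDeriv f f')
    (hg : HasWeakDeriv g g')
    (hf2 : Summable fun k : ℤ => (k : ℝ) ^ 2 * ‖fourierCoeff f k‖ ^ 2)
    (hg2 : Summable fun k : ℤ => (k : ℝ) ^ 2 * ‖fourierCoeff g k‖ ^ 2) :
    (fun N : ℕ => ginibreCov N (ofPhase f) (ofPhase g) -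
        ((Real.log N / 4 : ℝ) : ℂ) * ∫ θ, f' θ * g' θ ∂circMeasure)
      =o[atTop] fun N : ℕ => Real.log N := by
  have hsum := hasSum_covError hf hg hf2 hg2
  have hbound : Summable fun m : ℤ =>
      5 / 4 * (|(m : ℝ)| * |(m : ℝ)| * ‖fourierCoeff f m * fourierCoeff g (-m)‖) :=
    (summable_weight_mul hf2
      (summable_neg_fourierCoeff (w := fun k : ℤ => (k : ℝ) ^ 2) (by simp) hg2)).mul_left _
  have hlim := tendsto_tsum_of_dominated_convergence (𝓕 := atTop)
    (f := fun (N : ℕ) (m : ℤ) => ((covError N m / Real.log N : ℝ) : ℂ) *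
      (fourierCoeff f m * fourierCoeff g (-m))) (g := fun _ => 0) hbound
    (fun m => by
      have h := (Complex.continuous_ofReal.tendsto 0).comp (tendsto_covError_div_log m)
      simpa using h.mul_const (fourierCoeff f m * fourierCoeff g (-m)))
    (by
      filter_upwards [eventually_ge_atTop 3] with N hN m
      have hlog : 0 < Real.log N := Real.log_pos (by exact_mod_cast (by omega : 1 < N))
      have h := abs_covError_le_log hN m
      rw [norm_mul, Complex.norm_real, norm_div, Real.norm_eq_abs, Real.norm_of_nonneg hlog.le,
        abs_mul_abs_self, ← sq, ← mul_assoc]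
      exact mul_le_mul_of_nonneg_right ((div_le_iff₀ hlog).2 h) (norm_nonneg _))
  rw [tsum_zero] at hlim
  rw [← isLittleO_norm_left, isLittleO_iff_tendsto']
  · refine (tendsto_norm_zero.comp hlim).congr fun N => ?_
    have h0 : 0 ≤ Real.log N := Real.log_natCast_nonneg N
    have h1 : ∀ m : ℤ, ((covError N m / Real.log N : ℝ) : ℂ) *
        (fourierCoeff f m * fourierCoeff g (-m)) =
        ((Real.log N : ℝ) : ℂ)⁻¹ * ((covError N m : ℂ) *
          (fourierCoeff f m * fourierCoeff g (-m))) := fun m => by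
      push_cast
      ring
    simp only [Function.comp_apply, h1]
    rw [tsum_mul_left, (hsum N).tsum_eq, norm_mul, norm_inv, Complex.norm_real,
      Real.norm_of_nonneg h0]
    exact (div_eq_inv_mul _ _).symm
  · filter_upwards [eventually_ge_atTop 2] with N hN h0
    exact absurd h0 (Real.log_pos (by exact_mod_cast hN)).ne'

theorem ginibreCov_isBigO {f g f' g' : Circ → ℂ} (hf : HasWeakDeriv f f')
    (hg : HasWeakDeriv g g')
    (hf2 : Summable fun k : ℤ => (k : ℝ) ^ 2 * ‖fourierCoeff f k‖ ^ 2)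
    (hg2 : Summable fun k : ℤ => (k : ℝ) ^ 2 * ‖fourierCoeff g k‖ ^ 2) {δ : ℝ} (hδ : 0 < δ)
    (h : (Summable fun k : ℤ => |(k : ℝ)| ^ (2 + δ) * ‖fourierCoeff f k‖ ^ 2) ∨
      Summable fun k : ℤ => |(k : ℝ)| ^ (2 + δ) * ‖fourierCoeff g k‖ ^ 2) :
    (fun N : ℕ => ginibreCov N (ofPhase f) (ofPhase g) -
        ((Real.log N / 4 : ℝ) : ℂ) * ∫ θ, f' θ * g' θ ∂circMeasure)
      =O[atTop] fun _ : ℕ => (1 : ℝ) := by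
  have hs := (summable_rpow_mul_fourierCoeff hf2 hg2 h).mul_left
    (5 / 4 + 2 ^ (δ / 2) / (δ / 2))
  refine IsBigO.of_bound (∑' m : ℤ, (5 / 4 + 2 ^ (δ / 2) / (δ / 2)) *
    (|(m : ℝ)| * |(m : ℝ)| ^ (1 + δ / 2) * ‖fourierCoeff f m * fourierCoeff g (-m)‖)) ?_
  filter_upwards [eventually_ge_atTop 1] with N hN
  rw [norm_one, mul_one, ← (hasSum_covError hf hg hf2 hg2 N).tsum_eq]
  refine tsum_of_norm_bounded hs.hasSum fun m => ?_
  rw [norm_mul, Complex.norm_real, Real.norm_eq_abs, ← mul_assoc]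
  exact mul_le_mul_of_nonneg_right (abs_covError_le_rpow hδ hN m) (norm_nonneg _)

theorem theorem4 (f g : Circ → ℂ)
    (hf : Integrable f circMeasure) (hg : Integrable g circMeasure)
    (hf2 : Summable fun k : ℤ => (k : ℝ) ^ 2 * ‖fourierCoeff f k‖ ^ 2)
    (hg2 : Summable fun k : ℤ => (k : ℝ) ^ 2 * ‖fourierCoeff g k‖ ^ 2) :
    -- `f` and `g` have square integrable weak derivatives
    (∃ f' : Circ → ℂ, HasWeakDeriv f f' ∧ MemLp f' 2 circMeasure) ∧
    (∃ g' : Circ → ℂ, HasWeakDeriv g g' ∧ MemLp g' 2 circMeasure) ∧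
    -- the statistics are square integrable, so that the covariance is a genuine one
    (∀ N : ℕ, MemLp (linearStatistic (ofPhase f)) 2 (ginibreLaw N) ∧
      MemLp (linearStatistic (ofPhase g)) 2 (ginibreLaw N)) ∧
    -- the asymptotics of the covariance
    ∀ f' g' : Circ → ℂ, HasWeakDeriv f f' → HasWeakDeriv g g' →
      ((fun N : ℕ => ginibreCov N (ofPhase f) (ofPhase g) -
          ((Real.log N / 4 : ℝ) : ℂ) * ∫ θ, f' θ * g' θ ∂circMeasure)
        =o[atTop] fun N : ℕ => Real.log N) ∧
      ((∃ δ : ℝ, 0 < δ ∧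
          ((Summable fun k : ℤ => |(k : ℝ)| ^ (2 + δ) * ‖fourierCoeff f k‖ ^ 2) ∨
            Summable fun k : ℤ => |(k : ℝ)| ^ (2 + δ) * ‖fourierCoeff g k‖ ^ 2)) →
        (fun N : ℕ => ginibreCov N (ofPhase f) (ofPhase g) -
          ((Real.log N / 4 : ℝ) : ℂ) * ∫ θ, f' θ * g' θ ∂circMeasure)
        =O[atTop] fun _ : ℕ => (1 : ℝ)) := by

  have hfc := exists_continuous_ae_eq hf (summable_fourierCoeff hf2)
  have hgc := exists_continuous_ae_eq hg (summable_fourierCoeff hg2)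
  refine ⟨exists_hasWeakDeriv hf hf2, exists_hasWeakDeriv hg hg2, fun N => ?_,
    fun f' g' hf' hg' => ⟨ginibreCov_isLittleO hf' hg' hf2 hg2, ?_⟩⟩
  · exact ⟨memLp_linearStatistic hfc.choose_spec N, memLp_linearStatistic hgc.choose_spec N⟩
  · rintro ⟨δ, hδ, h⟩
    exact ginibreCov_isBigO hf' hg' hf2 hg2 hδ h
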